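/- **Setting.** A MAPF instance consists of a finite undirected graph and $k$ agents with pairwise distinct start vertices and pairwise distinct target vertices $l_i$. In each timestep an agent waits or moves along an edge; it finally waits forever at its target, and the cost of its path is the first timestep from which it does so. Two paths have a vertex conflict (same vertex, same timestep) or an edge conflict (same edge in opposite directions in the same timestep). A solution is a conflict-free choice of one path per agent, $C^*$ is the minimum sum of path costs (SOC) of a solution, and $w\ge 1$ is a real number. **EECBS.** A constraint-tree (CT) node $N$ holds for each agent $i$ a finite set $\Psi_i(N)$ of vertex and edge constraints, a path of cost $c_i(N)$ and a lower bound $lb_i(N)$; let $C(N)=\sum_i c_i(N)$ and $LB(N)=\sum_i lb_i(N)$. LISTs is the collection of generated nodes whose expansion is not completed (a node being expanded stays in LISTs until its children have been generated), and $LB=\min_{N\in\text{LISTs}}LB(N)$. The node $N$ is *locally bounded-suboptimal* if $C(N)\le w\,LB(N)$ and *globally bounded-suboptimal* if $C(N)\le w\,LB$. In the root, which has no constraints, the agents are planned one after the other by focal search with zero flex and inherited lower bound $0$. Each iteration selects a globally bounded-suboptimal node $\hat N$ in LISTs. If its paths are conflict-free, they are returned. Otherwise some conflict of agents $i,j$ is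 chosen and two children are generated one after the other, one forbidding $i$ and one forbidding $j$ the conflicting vertex or edge traversal at the conflicting timestep. In each child $N$ only the constrained agent $i$ is replanned, by focal search under $\Psi_i(N)$; the child is put into LISTs if a path is found. Focal search works on the tree of vertex-timestep nodes $n=(v,t)$ with $f(n)=t+h_i(v)$, where the natural number $h_i(v)$ is an admissible heuristic under $\Psi_i(N)$. In each iteration, with $f_{\min}$ the minimum $f$-value in OPEN, it takes a node with the fewest conflicts with the (already planned) paths of the other agents among the nodes in OPEN with $f(n)\le \tau_i=w\max\{f_{\min},lb_i(\hat N)\}+\Delta_i$. If the agent can stop there (the node is at the target, and waiting there forever respects the constraints), the search terminates with this path and $lb_i(N)=\max\{f_{\min},lb_i(\hat N)\}$; otherwise the node is expanded. It reports that there is no path when OPEN is empty. Duplicates (same vertex and timestep) may be eliminated. **MFD.** The flex $\Delta_i$ for replanning agent $i$ in a child $N$ of $\hat N$ is chosen as follows. Let $\Delta_{\max,i}=\sum_{j\ne i}(w\,lb_j(\hat N)-c_j(\hat N))$; let $\rho_i$ be the number of conflicts of agent $i$'s path with other paths in $\hat N$ divided by the number of conflicts among all pairs of paths in $\hat N$;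 let $\Delta_{d,i}=\min\{\Delta_{\max,i},\sum_{\psi\in\Psi_i(N)}d_\psi\}$ with real delay estimates $d_\psi$ whose sum is non-negative. 1. If $\Delta_{\max,i}<0$, then $\Delta_i=\Delta_{\max,i}$ (greedy distribution, GFD). 2. Otherwise $\Delta_i=\Delta_{d,i}+\rho_i(\Delta_{\max,i}-\Delta_{d,i})$ (DFD) if this value satisfies $$w\,lb_i(\hat N)+\Delta_i+\sum_{j\ne i}c_j(\hat N)\le w\,LB.\tag{$*$}$$ 3. Otherwise $\Delta_i=\rho_i\Delta_{\max,i}$ (CFD) if this value satisfies $(*)$. 4. Otherwise let $N_F$ be a node in LISTs with $LB(N_F)=LB$. If $\sum_{j\ne i}lb_j(N_F)<\sum_{j\ne i}lb_j(\hat N)$ and $\sum_{j\ne i}c_j(\hat N)<w\sum_{j\ne i}lb_j(N_F)$, then $\Delta_i$ is some flex with $0\le\Delta_i\le w\sum_{j\ne i}lb_j(N_F)-\sum_{j\ne i}c_j(\hat N)$, the modified maximum allowed flex. 5. If one of these two conditions fails, $\Delta_i=0$. All choices left open (selected node, conflict, order of the children, ties, $N_F$, the flex in 4) are arbitrary. **Theorem.**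 For all admissible heuristics and all such delay estimates: (a) EECBS with MFD is complete: if the instance is solvable, every run (including all its focal searches) is finite, and a run can end only by returning a solution. (b) EECBS with MFD is bounded-suboptimal: whatever a run returns is a solution with SOC at most $w\,C^*$. (c) Every CT node in LISTs is at all times locally bounded-suboptimal. Every flex used satisfies $0\le\Delta_i\le\Delta_{\max,i}$ if $\Delta_{\max,i}\ge 0$, and $\Delta_i=\Delta_{\max,i}$ if $\Delta_{\max,i}<0$. (d) If the flex for $N$ is obtained by rule 4 from $N_F$, a path is found, and $lb_i(N)=lb_i(\hat N)=lb_i(N_F)$, then $C(N)\le w\,LB$ for the value of $LB$ when $N$ is generated, i.e. $N$ is globally bounded-suboptimal. -/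

import Mathlib

noncomputable section

namespace EECBS

/-! ### Multi-agent path finding -/

/-- A MAPF instance with `k` agents on an undirected graph; distinct agents have distinct
start vertices and distinct target vertices. -/
structure Instance (V : Type*) (k : ℕ) where
  graph : SimpleGraph V
  start : Fin k → V
  target : Fin k → V
  start_injective : Function.Injective start
  target_injective : Function.Injective target

variable {V : Type*} {k : ℕ}

/-- `p t` is the vertex of agent `i` at timestep `t`. The agent starts at its start vertex, moves
along an edge or waits at every timestep, and ends up waiting forever at its target vertex. -/
def Instance.IsPath (I : Instance V k) (i : Fin k) (p : ℕ → V) : Prop :=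
  p 0 = I.start i ∧
  (∀ t, p (t + 1) = p t ∨ I.graph.Adj (p t) (p (t + 1))) ∧
  ∃ T, ∀ t, T ≤ t → p t = I.target i

/-- The cost of a path: the first timestep from which the agent waits forever at its target. -/
def Instance.pathCost (I : Instance V k) (i : Fin k) (p : ℕ → V) : ℕ :=
  sInf {T | ∀ t, T ≤ t → p t = I.target i}

/-- Both agents are at the same vertex at timestep `t`. -/
def VertexConflict (p q : ℕ → V) (t : ℕ) : Prop := p t = q t

/-- Both agents traverse the same edge in opposite directions between `t` and `t + 1`. -/
def EdgeConflict (p q : ℕ → V) (t : ℕ) : Prop :=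
  p t ≠ p (t + 1) ∧ q t = p (t + 1) ∧ q (t + 1) = p t

/-- No two of the paths have a conflict. -/
def ConflictFree (P : Fin k → ℕ → V) : Prop :=
  ∀ i j, i ≠ j → ∀ t, ¬ VertexConflict (P i) (P j) t ∧ ¬ EdgeConflict (P i) (P j) t

def Instance.IsSolution (I : Instance V k) (P : Fin k → ℕ → V) : Prop :=
  (∀ i, I.IsPath i (P i)) ∧ ConflictFree P

def Instance.Solvable (I : Instance V k) : Prop := ∃ P, I.IsSolution P

/-- Sum of path costs. -/
def Instance.soc (I : Instance V k) (P : Fin k → ℕ → V) : ℕ := ∑ i, I.pathCost i (P i)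

/-- `C*`, the minimum sum of path costs over all solutions (of a solvable instance). -/
def Instance.optCost (I : Instance V k) : ℕ := sInf {c | ∃ P, I.IsSolution P ∧ I.soc P = c}

/-! ### Constraints and constraint tree nodes -/

/-- `vertex v t`: do not be at `v` at timestep `t`.
`edge u v t`: do not move from `u` to `v` between timesteps `t` and `t + 1`. -/
inductive Constraint (V : Type*) where
  | vertex (v : V) (t : ℕ)
  | edge (u v : V) (t : ℕ)

def Constraint.Satisfied (p : ℕ → V) : Constraint V → Prop
  | .vertex v t => p t ≠ v
  | .edge u v t => ¬ (p t = u ∧ p (t + 1) = v)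

/-- A node `N` of the constraint tree (CT): the constraint sets `Ψ_i(N)`, one path per agent, and
the best-known lower bounds `lb_i(N)`. -/
structure CTNode (V : Type*) (k : ℕ) where
  constraints : Fin k → Finset (Constraint V)
  path : Fin k → ℕ → V
  lb : Fin k → ℕ

/-- `c_i(N)` -/
def CTNode.cost (I : Instance V k) (N : CTNode V k) (i : Fin k) : ℕ := I.pathCost i (N.path i)

/-- `C(N)` -/
def CTNode.soc (I : Instance V k) (N : CTNode V k) : ℕ := ∑ i, N.cost I i

/-- `LB(N)`, the sum of lower bounds (SOLB). -/
def CTNode.solb (N : CTNode V k) : ℕ := ∑ i, N.lb i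

/-- `LB`, the minimum SOLB among the CT nodes in LISTs. -/
def globalLB (L : Multiset (CTNode V k)) : ℕ := sInf {b | ∃ N ∈ L, N.solb = b}

/-- `C(N) ≤ w · LB(N)` -/
def LocallyBounded (I : Instance V k) (w : ℝ) (N : CTNode V k) : Prop :=
  (N.soc I : ℝ) ≤ w * (N.solb : ℝ)

/-- `C(N) ≤ w · LB` -/
def GloballyBounded (I : Instance V k) (w : ℝ) (L : Multiset (CTNode V k)) (N : CTNode V k) :
    Prop :=
  (N.soc I : ℝ) ≤ w * (globalLB L : ℝ)

/-- The number of conflicts between two paths. -/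
def numConflicts (p q : ℕ → V) : ℕ :=
  {t | VertexConflict p q t}.ncard + {t | EdgeConflict p q t}.ncard

/-- The number of conflicts of the path of agent `i` with the paths of the other agents. -/
def CTNode.agentConflicts (N : CTNode V k) (i : Fin k) : ℕ :=
  ∑ j ∈ Finset.univ.erase i, numConflicts (N.path i) (N.path j)

/-- The number of conflicts among all pairs of paths. -/
def CTNode.totalConflicts (N : CTNode V k) : ℕ :=
  ∑ i, ∑ j ∈ Finset.Ioi i, numConflicts (N.path i) (N.path j)

/-- Resolving a conflict of `N` between two agents: the additional constraint on the one agent for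
the first child, and the additional constraint on the other agent for the second child. -/
inductive Resolves (N : CTNode V k) : Fin k × Constraint V → Fin k × Constraint V → Prop
  | vertex (i j : Fin k) (t : ℕ) (hij : i ≠ j) (h : VertexConflict (N.path i) (N.path j) t) :
      Resolves N (i, .vertex (N.path i t) t) (j, .vertex (N.path j t) t)
  | edge (i j : Fin k) (t : ℕ) (hij : i ≠ j) (h : EdgeConflict (N.path i) (N.path j) t) :
      Resolves N (i, .edge (N.path i t) (N.path i (t + 1)) t)
        (j, .edge (N.path j t) (N.path j (t + 1)) t)

/-! ### Parameters of the algorithm -/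

/-- Suboptimality factor `w`, low-level heuristics `h i Ψ v` for agent `i` under the constraint
set `Ψ`, and delay estimates `delay N i ψ` used when agent `i` is replanned in a child of `N`. -/
structure Params (V : Type*) (k : ℕ) where
  w : ℝ
  h : Fin k → Finset (Constraint V) → V → ℕ
  delay : CTNode V k → Fin k → Constraint V → ℝ

/-- The heuristics never overestimate the number of timesteps that a path satisfying the
constraints still needs to reach the target. -/
def Params.Admissible (P : Params V k) (I : Instance V k) : Prop :=
  ∀ (i : Fin k) (Ψ : Finset (Constraint V)) (p : ℕ → V), I.IsPath i p →
    (∀ ψ ∈ Ψ, ψ.Satisfied p) →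
    ∀ t, t ≤ I.pathCost i p → t + P.h i Ψ (p t) ≤ I.pathCost i p

open Classical in
/-- `Ψ_i(N) = Ψ_i(N̂) ∪ {ψ}` for the child `N` of `N̂` with the additional constraint `ψ`. -/
def CTNode.childConstraints (Nhat : CTNode V k) (i : Fin k) (ψ : Constraint V) :
    Finset (Constraint V) :=
  insert ψ (Nhat.constraints i)

/-- The sum over `Ψ_i(N)` of the estimated delays. -/
def Params.totalDelay (P : Params V k) (Nhat : CTNode V k) (i : Fin k) (ψ : Constraint V) : ℝ :=
  ∑ φ ∈ Nhat.childConstraints i ψ, P.delay Nhat i φ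

/-! ### Low level: focal search -/

/-- A vertex-timestep node of the low-level search tree, together with its branch: `walk s` is the
vertex at timestep `s ≤ time` on the way from the root, and `walk` is constant from `time` on. -/
structure VTNode (V : Type*) where
  time : ℕ
  walk : ℕ → V

def VTNode.vertex (n : VTNode V) : V := n.walk n.time

/-- A call of the focal search: plan `agent` under `constraints`, counting conflicts with the paths
of the agents in `others`, with inherited lower bound `lbHat` and flex `flex`. -/
structure Query (V : Type*) (k : ℕ) where
  agent : Fin k
  constraints : Finset (Constraint V)
  others : Finset (Fin k)
  paths : Fin k → ℕ → V
  lbHat : ℕ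
  flex : ℝ

/-- `opened` is `OPEN_L`, the generated but not yet expanded nodes; `closed` the expanded ones. -/
structure SearchState (V : Type*) where
  opened : Set (VTNode V)
  closed : Set (VTNode V)

/-- The search starts with the single node `(s_i, 0)`. -/
def Query.init (Q : Query V k) (I : Instance V k) : SearchState V where
  opened := {⟨0, fun _ => I.start Q.agent⟩}
  closed := ∅

/-- The children of a v-t node: move along an edge or wait, respecting the constraints. -/
def Query.succ (Q : Query V k) (I : Instance V k) (n : VTNode V) : Set (VTNode V) :=
  {m | ∃ v : V, (v = n.vertex ∨ I.graph.Adj n.vertex v) ∧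
    Constraint.vertex v (n.time + 1) ∉ Q.constraints ∧
    Constraint.edge n.vertex v n.time ∉ Q.constraints ∧
    m = ⟨n.time + 1, fun s => if s ≤ n.time then n.walk s else v⟩}

/-- The node is at the target vertex, and waiting there forever satisfies the constraints. -/
def Query.IsGoal (Q : Query V k) (I : Instance V k) (n : VTNode V) : Prop :=
  n.vertex = I.target Q.agent ∧
  ∀ t, n.time < t → Constraint.vertex (I.target Q.agent) t ∉ Q.constraints

/-- `f_i(n) = g_i(n) + h_i(v)` -/
def Query.f (Q : Query V k) (P : Params V k) (n : VTNode V) : ℕ :=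
  n.time + P.h Q.agent Q.constraints n.vertex

/-- `x_i(n)`, the number of conflicts with the other paths on the way from `(s_i, 0)` to `n`. -/
def Query.x (Q : Query V k) (n : VTNode V) : ℕ :=
  ∑ j ∈ Q.others, ({t | t ≤ n.time ∧ VertexConflict n.walk (Q.paths j) t}.ncard +
    {t | t < n.time ∧ EdgeConflict n.walk (Q.paths j) t}.ncard)

/-- `f_min`, the minimum `f`-value in `OPEN_L`. -/
def Query.fmin (Q : Query V k) (P : Params V k) (S : SearchState V) : ℕ :=
  sInf {b | ∃ n ∈ S.opened, Q.f P n = b}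

/-- The threshold `τ = w · max{f_min, lb_i(N̂)} + Δ`. -/
def Query.threshold (Q : Query V k) (P : Params V k) (S : SearchState V) : ℝ :=
  P.w * ((max (Q.fmin P S) Q.lbHat : ℕ) : ℝ) + Q.flex

/-- `FOCAL_L` -/
def Query.focal (Q : Query V k) (P : Params V k) (S : SearchState V) : Set (VTNode V) :=
  {n | n ∈ S.opened ∧ (Q.f P n : ℝ) ≤ Q.threshold P S}

/-- `n` is a node of `FOCAL_L` with the least number of conflicts. -/
def Query.IsTop (Q : Query V k) (P : Params V k) (S : SearchState V) (n : VTNode V) : Prop :=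
  n ∈ Q.focal P S ∧ ∀ m ∈ Q.focal P S, Q.x n ≤ Q.x m

/-- One iteration of the focal search whose top node is not a goal: this node is expanded.
Duplicate elimination is optional and arbitrary: a node may be dropped from `OPEN_L` (or not be
inserted) only if a node with the same vertex and timestep is in `OPEN_L` or was expanded. -/
def Query.Step (Q : Query V k) (I : Instance V k) (P : Params V k) (S S' : SearchState V) : Prop :=
  ∃ n, Q.IsTop P S n ∧ ¬ Q.IsGoal I n ∧
    S'.closed = insert n S.closed ∧
    S'.opened ⊆ (S.opened \ {n}) ∪ Q.succ I n ∧
    ∀ m ∈ (S.opened \ {n}) ∪ Q.succ I n, ∃ m' ∈ S'.opened ∪ S'.closed,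
      m'.time = m.time ∧ m'.vertex = m.vertex

/-- The focal search terminates in state `S` with path `p` and lower bound
`lb = max{f_min, lb_i(N̂)}`: the top node of `FOCAL_L` is a goal. -/
def Query.Finds (Q : Query V k) (I : Instance V k) (P : Params V k) (S : SearchState V)
    (p : ℕ → V) (lb : ℕ) : Prop :=
  ∃ n, Q.IsTop P S n ∧ Q.IsGoal I n ∧ p = n.walk ∧ lb = max (Q.fmin P S) Q.lbHat

/-! ### Flex distribution -/

/-- Sum over the agents other than `i`. -/
def sumOthers (i : Fin k) (a : Fin k → ℕ) : ℝ := ∑ j ∈ Finset.univ.erase i, (a j : ℝ)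

/-- The maximum allowed flex `∑_{j ≠ i} (w · lb_j(N̂) - c_j(N̂))`. -/
def maxFlex (I : Instance V k) (P : Params V k) (Nhat : CTNode V k) (i : Fin k) : ℝ :=
  ∑ j ∈ Finset.univ.erase i, (P.w * (Nhat.lb j : ℝ) - (Nhat.cost I j : ℝ))

/-- `ρ_i` -/
def conflictRatio (Nhat : CTNode V k) (i : Fin k) : ℝ :=
  (Nhat.agentConflicts i : ℝ) / (Nhat.totalConflicts : ℝ)

/-- `Δ_{d,i} = min{Δ_{max,i}, ∑ d_ψ}` -/
def delayFlex (I : Instance V k) (P : Params V k) (Nhat : CTNode V k) (i : Fin k)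
    (ψ : Constraint V) : ℝ :=
  min (maxFlex I P Nhat i) (P.totalDelay Nhat i ψ)

/-- The DFD flex for a non-negative maximum allowed flex. -/
def dfdFlex (I : Instance V k) (P : Params V k) (Nhat : CTNode V k) (i : Fin k)
    (ψ : Constraint V) : ℝ :=
  delayFlex I P Nhat i ψ +
    conflictRatio Nhat i * (maxFlex I P Nhat i - delayFlex I P Nhat i ψ)

/-- The CFD flex for a non-negative maximum allowed flex. -/
def cfdFlex (I : Instance V k) (P : Params V k) (Nhat : CTNode V k) (i : Fin k) : ℝ :=
  conflictRatio Nhat i * maxFlex I P Nhat i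

/-- The check `w · lb_i(N̂) + Δ + ∑_{j ≠ i} c_j ≤ w · LB`. -/
def Fits (I : Instance V k) (P : Params V k) (L : Multiset (CTNode V k)) (Nhat : CTNode V k)
    (i : Fin k) (Δ : ℝ) : Prop :=
  P.w * (Nhat.lb i : ℝ) + Δ + sumOthers i (Nhat.cost I) ≤ P.w * (globalLB L : ℝ)

/-- `N_F` is a CT node in LISTs with `LB(N_F) = LB`. -/
def IsFront (L : Multiset (CTNode V k)) (NF : CTNode V k) : Prop :=
  NF ∈ L ∧ NF.solb = globalLB L

/-- The two side conditions for recomputing the flex from `N_F`. -/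
def FrontConditions (I : Instance V k) (P : Params V k) (Nhat NF : CTNode V k) (i : Fin k) :
    Prop :=
  sumOthers i NF.lb < sumOthers i Nhat.lb ∧
  sumOthers i (Nhat.cost I) < P.w * sumOthers i NF.lb

/-- The modified maximum allowed flex computed from `N_F`. -/
def frontMaxFlex (I : Instance V k) (P : Params V k) (Nhat NF : CTNode V k) (i : Fin k) : ℝ :=
  P.w * sumOthers i NF.lb - sumOthers i (Nhat.cost I)

/-- The rule from which MFD obtains the flex. -/
inductive FlexSource (V : Type*) (k : ℕ) where
  | gfd
  | dfd
  | cfd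
  | front (NF : CTNode V k)
  | zero

/-- `MFD I P L Nhat i ψ src Δ`: Mixed-Strategy Flex Distribution, called with LISTs `L` to replan
agent `i` in the child of `Nhat` with the additional constraint `ψ`, distributes flex `Δ` by rule
`src`. In the rule `front`, the modified maximum allowed flex is only an upper limit: any
non-negative flex up to it may be distributed. -/
inductive MFD (I : Instance V k) (P : Params V k) (L : Multiset (CTNode V k)) (Nhat : CTNode V k)
    (i : Fin k) (ψ : Constraint V) : FlexSource V k → ℝ → Prop
  | gfd (hneg : maxFlex I P Nhat i < 0) : MFD I P L Nhat i ψ .gfd (maxFlex I P Nhat i)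
  | dfd (hnonneg : 0 ≤ maxFlex I P Nhat i)
      (hfit : Fits I P L Nhat i (dfdFlex I P Nhat i ψ)) :
      MFD I P L Nhat i ψ .dfd (dfdFlex I P Nhat i ψ)
  | cfd (hnonneg : 0 ≤ maxFlex I P Nhat i)
      (hnodfd : ¬ Fits I P L Nhat i (dfdFlex I P Nhat i ψ))
      (hfit : Fits I P L Nhat i (cfdFlex I P Nhat i)) :
      MFD I P L Nhat i ψ .cfd (cfdFlex I P Nhat i)
  | front (NF : CTNode V k) (Δ : ℝ) (hnonneg : 0 ≤ maxFlex I P Nhat i)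
      (hnodfd : ¬ Fits I P L Nhat i (dfdFlex I P Nhat i ψ))
      (hnocfd : ¬ Fits I P L Nhat i (cfdFlex I P Nhat i))
      (hNF : IsFront L NF) (hcond : FrontConditions I P Nhat NF i)
      (hΔ0 : 0 ≤ Δ) (hΔ : Δ ≤ frontMaxFlex I P Nhat NF i) :
      MFD I P L Nhat i ψ (.front NF) Δ
  | zero (NF : CTNode V k) (hnonneg : 0 ≤ maxFlex I P Nhat i)
      (hnodfd : ¬ Fits I P L Nhat i (dfdFlex I P Nhat i ψ))
      (hnocfd : ¬ Fits I P L Nhat i (cfdFlex I P Nhat i))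
      (hNF : IsFront L NF) (hcond : ¬ FrontConditions I P Nhat NF i) :
      MFD I P L Nhat i ψ .zero 0

/-! ### High level: EECBS with MFD as a nondeterministic machine -/

/-- The node obtained from `N` by giving agent `i` the constraints `Ψ`, path `p`, lower bound `b`. -/
def CTNode.replan (N : CTNode V k) (i : Fin k) (Ψ : Finset (Constraint V)) (p : ℕ → V) (b : ℕ) :
    CTNode V k where
  constraints := Function.update N.constraints i Ψ
  path := Function.update N.path i p
  lb := Function.update N.lb i b

/-- Search for the path of agent `i` in the root CT node: no constraints, no flex; the agents are
planned one after the other. -/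
def rootQuery (N : CTNode V k) (i : Fin k) : Query V k where
  agent := i
  constraints := ∅
  others := Finset.Iio i
  paths := N.path
  lbHat := 0
  flex := 0

/-- Search for the path of agent `i` in the child of `Nhat` with the additional constraint `ψ`. -/
def childQuery (Nhat : CTNode V k) (i : Fin k) (ψ : Constraint V) (Δ : ℝ) : Query V k where
  agent := i
  constraints := Nhat.childConstraints i ψ
  others := Finset.univ.erase i
  paths := Nhat.path
  lbHat := Nhat.lb i
  flex := Δ

/-- Configurations: while the root is built (the agents with index below `m` have been planned,
or agent `i` is being planned); when a CT node is to be selected from LISTs `L`; while `Nhat` is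
being expanded (`pending` lists the children that are still to be generated); during the low-level
search for a child; and after termination. -/
inductive Config (V : Type*) (k : ℕ) where
  | root (m : ℕ) (N : CTNode V k)
  | rootSearch (i : Fin k) (N : CTNode V k) (S : SearchState V)
  | select (L : Multiset (CTNode V k))
  | expand (L : Multiset (CTNode V k)) (Nhat : CTNode V k) (pending : List (Fin k × Constraint V))
  | search (L : Multiset (CTNode V k)) (Nhat : CTNode V k) (i : Fin k) (ψ : Constraint V)
      (src : FlexSource V k) (Δ : ℝ) (S : SearchState V) (pending : List (Fin k × Constraint V))
  | returned (N : CTNode V k)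
  | failed

/-- The CT nodes currently in LISTs. -/
def Config.lists : Config V k → Multiset (CTNode V k)
  | .select L => L
  | .expand L _ _ => L
  | .search L _ _ _ _ _ _ _ => L
  | _ => 0

/-- The initial configuration; no agent has been planned, so the node only holds placeholders. -/
def Config.init (I : Instance V k) : Config V k :=
  .root 0 ⟨fun _ => ∅, fun i _ => I.start i, fun _ => 0⟩

/-- One step of EECBS with MFD. Any globally bounded-suboptimal CT node may be selected and any of
its conflicts may be resolved; it is removed from LISTs once its children have been generated. -/
inductive Step (I : Instance V k) (P : Params V k) : Config V k → Config V k → Prop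
  | rootNext (N : CTNode V k) (i : Fin k) :
      Step I P (.root i N) (.rootSearch i N ((rootQuery N i).init I))
  | rootStep (i : Fin k) (N : CTNode V k) (S S' : SearchState V)
      (h : (rootQuery N i).Step I P S S') :
      Step I P (.rootSearch i N S) (.rootSearch i N S')
  | rootFound (i : Fin k) (N : CTNode V k) (S : SearchState V) (p : ℕ → V) (b : ℕ)
      (h : (rootQuery N i).Finds I P S p b) :
      Step I P (.rootSearch i N S) (.root (i + 1) (N.replan i ∅ p b))
  | rootNoPath (i : Fin k) (N : CTNode V k) (S : SearchState V) (h : S.opened = ∅) :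
      Step I P (.rootSearch i N S) .failed
  | rootDone (N : CTNode V k) : Step I P (.root k N) (.select {N})
  | noNode : Step I P (.select 0) .failed
  | solved (L : Multiset (CTNode V k)) (Nhat : CTNode V k) (hmem : Nhat ∈ L)
      (hgb : GloballyBounded I P.w L Nhat) (hfree : ConflictFree Nhat.path) :
      Step I P (.select L) (.returned Nhat)
  | split (L : Multiset (CTNode V k)) (Nhat : CTNode V k) (a b : Fin k × Constraint V)
      (hmem : Nhat ∈ L) (hgb : GloballyBounded I P.w L Nhat) (hres : Resolves Nhat a b) :
      Step I P (.select L) (.expand L Nhat [a, b])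
  | childStart (L : Multiset (CTNode V k)) (Nhat : CTNode V k) (i : Fin k) (ψ : Constraint V)
      (pending : List (Fin k × Constraint V)) (src : FlexSource V k) (Δ : ℝ)
      (h : MFD I P L Nhat i ψ src Δ) :
      Step I P (.expand L Nhat ((i, ψ) :: pending))
        (.search L Nhat i ψ src Δ ((childQuery Nhat i ψ Δ).init I) pending)
  | childStep (L : Multiset (CTNode V k)) (Nhat : CTNode V k) (i : Fin k) (ψ : Constraint V)
      (src : FlexSource V k) (Δ : ℝ) (S S' : SearchState V)
      (pending : List (Fin k × Constraint V)) (h : (childQuery Nhat i ψ Δ).Step I P S S') :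
      Step I P (.search L Nhat i ψ src Δ S pending) (.search L Nhat i ψ src Δ S' pending)
  | childFound (L : Multiset (CTNode V k)) (Nhat : CTNode V k) (i : Fin k) (ψ : Constraint V)
      (src : FlexSource V k) (Δ : ℝ) (S : SearchState V)
      (pending : List (Fin k × Constraint V)) (p : ℕ → V) (b : ℕ)
      (h : (childQuery Nhat i ψ Δ).Finds I P S p b) :
      Step I P (.search L Nhat i ψ src Δ S pending)
        (.expand (Nhat.replan i (Nhat.childConstraints i ψ) p b ::ₘ L) Nhat pending)
  | childNoPath (L : Multiset (CTNode V k)) (Nhat : CTNode V k) (i : Fin k) (ψ : Constraint V)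
      (src : FlexSource V k) (Δ : ℝ) (S : SearchState V)
      (pending : List (Fin k × Constraint V)) (h : S.opened = ∅) :
      Step I P (.search L Nhat i ψ src Δ S pending) (.expand L Nhat pending)
  | expandDone (L : Multiset (CTNode V k)) (Nhat : CTNode V k) :
      Step I P (.expand (Nhat ::ₘ L) Nhat []) (.select L)

/-- The configuration occurs in some run of the algorithm. -/
def Reachable (I : Instance V k) (P : Params V k) (c : Config V k) : Prop :=
  Relation.ReflTransGen (Step I P) (Config.init I) c

/-- Completeness: on a solvable instance, every run, whatever the choices made in it, is finite,
and it can end only by returning a solution. -/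
def Complete (I : Instance V k) (P : Params V k) : Prop :=
  I.Solvable →
    (¬ ∃ run : ℕ → Config V k, run 0 = Config.init I ∧ ∀ n, Step I P (run n) (run (n + 1))) ∧
    ∀ c, Reachable I P c → (∀ c', ¬ Step I P c c') →
      ∃ N, c = .returned N ∧ I.IsSolution N.path

/-- Bounded suboptimality: whatever is returned is a solution with SOC at most `w · C*`. -/
def BoundedSuboptimal (I : Instance V k) (P : Params V k) : Prop :=
  ∀ N, Reachable I P (.returned N) →
    I.IsSolution N.path ∧ (I.soc N.path : ℝ) ≤ P.w * (I.optCost : ℝ)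

end EECBS

end

namespace EECBS

variable {V : Type*} {k : ℕ}

/-! ### Paths -/

/-! Two kinds of invariants are carried along a run.

The first (`CTNode.Good`) needs no solvability: each `lb i` is at most the cost of every path of
agent `i` satisfying its constraints, and the node is locally bounded-suboptimal. The lower bound is
sound because OPEN always holds a node lying on any given feasible path, up to duplicates
(`Query.SearchInv.exists_opened`), so `fmin` never exceeds the cost of that path. Local boundedness
passes to a child since the new path costs at most `w * lb + Δ`, while every rule of MFD keeps `Δ`
below the slack `maxFlex` left by the other agents (`MFD.mem_Icc`). A negative flex cannot empty
FOCAL: by local boundedness of the parent, the slack of agent `i` itself pays for the deficit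
(`CTNode.Good.le_threshold`). In rule 4 the flex is measured against the front node, so the same
computation bounds the SOC by `w * LB`.

The second (`Config.Live`) is relative to a fixed solution `R`. As `R` cannot violate both
constraints of a split, once the root is built a node permitting `R` is always in LISTs or still to
be generated (`Config.Live.step`). Hence `LB` is at most the SOC of `R`, and a returned node costs
at most `w` times that; an optimal `R` gives bounded suboptimality. Moreover, every selected node
obeys this cost bound, so its conflicts, and thus all constraints ever created, lie at bounded
timesteps. On a finite graph there are finitely many such constraints, and each child has one more
than its parent, so the constraint tree is finite. Each focal search is finite too, even an
infeasible one (`Query.exists_time_bound`). -/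

theorem Instance.IsPath.eq_target {I : Instance V k} {i : Fin k} {p : ℕ → V} (hp : I.IsPath i p)
    {t : ℕ} (ht : I.pathCost i p ≤ t) : p t = I.target i := by
  have h : I.pathCost i p ∈ {T | ∀ t, T ≤ t → p t = I.target i} := Nat.sInf_mem hp.2.2
  exact h t ht

theorem Instance.pathCost_le {I : Instance V k} {i : Fin k} {p : ℕ → V} {T : ℕ}
    (h : ∀ t, T ≤ t → p t = I.target i) : I.pathCost i p ≤ T :=
  Nat.sInf_le h

theorem reachable_of_steps {G : SimpleGraph V} {p : ℕ → V} {T : ℕ}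
    (h : ∀ s, s < T → p (s + 1) = p s ∨ G.Adj (p s) (p (s + 1))) : G.Reachable (p 0) (p T) := by
  induction T with
  | zero => exact SimpleGraph.Reachable.refl _
  | succ T ih =>
    refine (ih fun s hs => h s (by omega)).trans ?_
    rcases h T (by omega) with h | h
    · rw [h]
    · exact h.reachable

theorem Instance.IsPath.reachable {I : Instance V k} {i : Fin k} {p : ℕ → V}
    (hp : I.IsPath i p) : I.graph.Reachable (I.start i) (I.target i) := by
  obtain ⟨T, hT⟩ := hp.2.2
  rw [← hp.1, ← hT T le_rfl]
  exact reachable_of_steps fun s _ => hp.2.1 s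

/-! ### Constraints -/

/-- The timestep of a constraint. -/
def Constraint.time : Constraint V → ℕ
  | .vertex _ t => t
  | .edge _ _ t => t

/-- The constraint concerns neither the start of a path nor waiting. -/
def Constraint.Proper : Constraint V → Prop
  | .vertex _ t => 0 < t
  | .edge u v _ => u ≠ v

theorem Constraint.finite_time_le [Finite V] (B : ℕ) :
    {ψ : Constraint V | ψ.time ≤ B}.Finite := by
  let g : (V × Fin (B + 1)) ⊕ (V × V × Fin (B + 1)) → Constraint V
    | .inl (v, t) => .vertex v t
    | .inr (u, v, t) => .edge u v t
  refine (Set.finite_range g).subset ?_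
  rintro (⟨v, t⟩ | ⟨u, v, t⟩) ht
  · exact ⟨.inl (v, ⟨t, Nat.lt_succ_of_le ht⟩), rfl⟩
  · exact ⟨.inr (u, v, ⟨t, Nat.lt_succ_of_le ht⟩), rfl⟩

theorem Constraint.exists_time_lt (Ψ : Finset (Constraint V)) : ∃ T, ∀ ψ ∈ Ψ, ψ.time < T :=
  ⟨Ψ.sup Constraint.time + 1, fun _ hψ => Nat.lt_succ_of_le (Finset.le_sup hψ)⟩

/-! ### Branches of the low-level search tree -/

/-- `n` is a node of the low-level search tree. -/
structure Query.Branch (Q : Query V k) (I : Instance V k) (n : VTNode V) : Prop where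
  start : n.walk 0 = I.start Q.agent
  step : ∀ s, s < n.time →
    n.walk (s + 1) = n.walk s ∨ I.graph.Adj (n.walk s) (n.walk (s + 1))
  vertex : ∀ s, s < n.time → Constraint.vertex (n.walk (s + 1)) (s + 1) ∉ Q.constraints
  edge : ∀ s, s < n.time → Constraint.edge (n.walk s) (n.walk (s + 1)) s ∉ Q.constraints
  const : ∀ s, n.time ≤ s → n.walk s = n.vertex

/-- The node `(v, n.time + 1)` below `n`. -/
def VTNode.extend (n : VTNode V) (v : V) : VTNode V :=
  ⟨n.time + 1, fun s => if s ≤ n.time then n.walk s else v⟩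

theorem VTNode.extend_walk_le (n : VTNode V) (v : V) {s : ℕ} (h : s ≤ n.time) :
    (n.extend v).walk s = n.walk s := if_pos h

theorem VTNode.extend_walk_gt (n : VTNode V) (v : V) {s : ℕ} (h : n.time < s) :
    (n.extend v).walk s = v := if_neg (by omega)

theorem VTNode.extend_vertex (n : VTNode V) (v : V) : (n.extend v).vertex = v :=
  n.extend_walk_gt v (Nat.lt_succ_self _)

theorem Query.mem_succ {Q : Query V k} {I : Instance V k} {n m : VTNode V} :
    m ∈ Q.succ I n ↔ ∃ v : V, (v = n.vertex ∨ I.graph.Adj n.vertex v) ∧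
      Constraint.vertex v (n.time + 1) ∉ Q.constraints ∧
      Constraint.edge n.vertex v n.time ∉ Q.constraints ∧ m = n.extend v := Iff.rfl

theorem Query.time_of_mem_succ {Q : Query V k} {I : Instance V k} {n m : VTNode V}
    (h : m ∈ Q.succ I n) : m.time = n.time + 1 := by
  obtain ⟨v, -, -, -, rfl⟩ := h
  rfl

theorem Query.Branch.succ {Q : Query V k} {I : Instance V k} {n m : VTNode V}
    (hn : Q.Branch I n) (hm : m ∈ Q.succ I n) : Q.Branch I m := by
  obtain ⟨v, hv, hc, he, rfl⟩ := Query.mem_succ.1 hm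
  have hlast : ∀ s, s < (n.extend v).time → s < n.time ∨ s = n.time := fun s hs =>
    Nat.lt_or_eq_of_le (Nat.le_of_lt_succ hs)
  constructor
  · rw [n.extend_walk_le v (Nat.zero_le _)]
    exact hn.start
  · intro s hs
    rcases hlast s hs with h | rfl
    · rw [n.extend_walk_le v h, n.extend_walk_le v h.le]
      exact hn.step s h
    · rw [n.extend_walk_le v le_rfl, n.extend_walk_gt v (Nat.lt_succ_self _)]
      exact hv
  · intro s hs
    rcases hlast s hs with h | rfl
    · rw [n.extend_walk_le v h]
      exact hn.vertex s h
    · rw [n.extend_walk_gt v (Nat.lt_succ_self _)]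
      exact hc
  · intro s hs
    rcases hlast s hs with h | rfl
    · rw [n.extend_walk_le v h, n.extend_walk_le v h.le]
      exact hn.edge s h
    · rw [n.extend_walk_le v le_rfl, n.extend_walk_gt v (Nat.lt_succ_self _)]
      exact he
  · intro s hs
    rw [n.extend_walk_gt v hs, n.extend_vertex]

/-- A node of the search tree has only one parent. -/
theorem Query.Branch.parent_unique {Q : Query V k} {I : Instance V k} {n n' m : VTNode V}
    (hn : Q.Branch I n) (hn' : Q.Branch I n') (hm : m ∈ Q.succ I n) (hm' : m ∈ Q.succ I n') :
    n = n' := by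
  have ht : n.time = n'.time := by
    have h1 := Query.time_of_mem_succ hm
    have h2 := Query.time_of_mem_succ hm'
    omega
  obtain ⟨v, -, -, -, rfl⟩ := Query.mem_succ.1 hm
  obtain ⟨v', -, -, -, h⟩ := Query.mem_succ.1 hm'
  have hle : ∀ s, s ≤ n.time → n.walk s = n'.walk s := fun s hs => by
    rw [← n.extend_walk_le v hs, h, n'.extend_walk_le v' (ht ▸ hs)]
  -- Agreement up to `n.time` suffices: both walks are constant from there on.
  have hw : n.walk = n'.walk := by
    funext s
    rcases le_total s n.time with hs | hs
    · exact hle s hs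
    · rw [hn.const s hs, hn'.const s (ht ▸ hs), VTNode.vertex, VTNode.vertex, ← ht]
      exact hle _ le_rfl
  cases n
  cases n'
  simp_all

theorem Query.Branch.reachable {Q : Query V k} {I : Instance V k} {n : VTNode V}
    (hn : Q.Branch I n) : I.graph.Reachable (I.start Q.agent) n.vertex := by
  rw [← hn.start]
  exact reachable_of_steps hn.step

/-- The branch of a goal node is a path that satisfies the constraints. -/
theorem Query.Branch.isPath {Q : Query V k} {I : Instance V k} {n : VTNode V}
    (hn : Q.Branch I n) (hg : Q.IsGoal I n) : I.IsPath Q.agent n.walk := by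
  refine ⟨hn.start, fun t => ?_, n.time, fun t ht => (hn.const t ht).trans hg.1⟩
  rcases lt_or_ge t n.time with h | h
  · exact hn.step t h
  · left
    rw [hn.const t h, hn.const (t + 1) (by omega)]

theorem Query.Branch.pathCost_le {Q : Query V k} {I : Instance V k} {n : VTNode V}
    (hn : Q.Branch I n) (hg : Q.IsGoal I n) : I.pathCost Q.agent n.walk ≤ n.time :=
  Instance.pathCost_le fun t ht => (hn.const t ht).trans hg.1

/-- Expansion checks the constraints at moves up to `n.time`, and the goal test checks vertex
constraints at the target afterwards. What neither checks is a vertex constraint at timestep 0 and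
an edge constraint on waiting; properness excludes exactly these. -/
theorem Query.Branch.satisfied {Q : Query V k} {I : Instance V k} {n : VTNode V}
    (hn : Q.Branch I n) (hg : Q.IsGoal I n) (hQ : ∀ ψ ∈ Q.constraints, ψ.Proper) :
    ∀ ψ ∈ Q.constraints, ψ.Satisfied n.walk := by
  rintro (⟨v, t⟩ | ⟨u, v, t⟩) hψ
  · rintro rfl
    obtain ⟨s, rfl⟩ := Nat.exists_eq_succ_of_ne_zero (hQ _ hψ).ne'
    rcases lt_or_ge s n.time with h | h
    · exact hn.vertex s h hψ
    · refine hg.2 (s + 1) (by omega) ?_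
      rw [← hg.1, ← hn.const (s + 1) (by omega)]
      exact hψ
  · rintro ⟨rfl, rfl⟩
    rcases lt_or_ge t n.time with h | h
    · exact hn.edge t h hψ
    · exact hQ _ hψ (by rw [hn.const t h, hn.const (t + 1) (by omega)])

/-- A branch that lasts longer than the constraints can be continued to a path. -/
theorem Query.Branch.exists_path {Q : Query V k} {I : Instance V k} {n : VTNode V}
    (hn : Q.Branch I n) (hQ : ∀ ψ ∈ Q.constraints, ψ.Proper)
    (hr : I.graph.Reachable (I.start Q.agent) (I.target Q.agent))
    (hT : ∀ ψ ∈ Q.constraints, ψ.time < n.time) :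
    ∃ p, I.IsPath Q.agent p ∧ ∀ ψ ∈ Q.constraints, ψ.Satisfied p := by
  -- A walk back to the start and on to the target. It is traversed only after all constraints have
  -- expired; past its end `getVert` stays at the target.
  obtain ⟨W⟩ := hn.reachable.symm.trans hr
  let p : ℕ → V := fun s => if s ≤ n.time then n.walk s else W.getVert (s - n.time)
  have hle : ∀ s, s ≤ n.time → p s = n.walk s := fun s hs => if_pos hs
  have hge : ∀ s, p (n.time + s) = W.getVert s := by
    intro s
    rcases Nat.eq_zero_or_pos s with rfl | hs
    · rw [W.getVert_zero]
      exact hle _ le_rfl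
    · refine (if_neg (by omega)).trans ?_
      rw [Nat.add_sub_cancel_left]
  refine ⟨p, ⟨(hle 0 (Nat.zero_le _)).trans hn.start, fun t => ?_, n.time + W.length, ?_⟩, ?_⟩
  · rcases lt_or_ge t n.time with h | h
    · rw [hle t h.le, hle (t + 1) h]
      exact hn.step t h
    · obtain ⟨s, rfl⟩ := Nat.exists_eq_add_of_le h
      rw [add_assoc, hge, hge]
      rcases lt_or_ge s W.length with h | h
      · exact .inr (W.adj_getVert_succ h)
      · left
        rw [W.getVert_of_length_le h, W.getVert_of_length_le (by omega)]
  · intro t ht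
    obtain ⟨s, rfl⟩ := Nat.exists_eq_add_of_le ht
    rw [add_assoc, hge]
    exact W.getVert_of_length_le (by omega)
  · rintro (⟨v, t⟩ | ⟨u, v, t⟩) hψ
    · rintro rfl
      obtain ⟨s, rfl⟩ := Nat.exists_eq_succ_of_ne_zero (hQ _ hψ).ne'
      have hs : s + 1 < n.time := hT _ hψ
      rw [Nat.succ_eq_add_one, hle _ hs.le] at hψ
      exact hn.vertex s (by omega) hψ
    · rintro ⟨rfl, rfl⟩
      have hs : t < n.time := hT _ hψ
      rw [hle _ hs.le, hle _ hs] at hψ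
      exact hn.edge t hs hψ

/-- A branch of length at most `B` is determined by its length and its restriction to the timesteps
`0, ..., B`, because it is constant afterwards. -/
theorem Query.finite_branch [Finite V] (Q : Query V k) (I : Instance V k) (B : ℕ) :
    {n | Q.Branch I n ∧ n.time ≤ B}.Finite := by
  let g : VTNode V → ℕ × (Fin (B + 1) → V) := fun n => (n.time, fun s => n.walk s)
  have hfin : (Set.Iic B ×ˢ (Set.univ : Set (Fin (B + 1) → V))).Finite :=
    (Set.finite_Iic B).prod Set.finite_univ
  refine Set.Finite.of_finite_image (f := g) (hfin.subset ?_) ?_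
  · rintro _ ⟨n, hn, rfl⟩
    exact ⟨hn.2, trivial⟩
  · rintro n ⟨hn, hnB⟩ m ⟨hm, hmB⟩ h
    have ht : n.time = m.time := congrArg Prod.fst h
    have hle : ∀ s, s ≤ B → n.walk s = m.walk s := fun s hs =>
      congrFun (congrArg Prod.snd h) ⟨s, Nat.lt_succ_of_le hs⟩
    have hw : n.walk = m.walk := by
      funext s
      rcases le_total s B with hs | hs
      · exact hle s hs
      · rw [hn.const s (by omega), hm.const s (by omega), VTNode.vertex, VTNode.vertex, ← ht]
        exact hle _ hnB
    cases n
    cases m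
    simp_all

/-! ### Invariants of the focal search -/

/-- Invariants of the focal search. -/
structure Query.SearchInv (Q : Query V k) (I : Instance V k) (S : SearchState V) : Prop where
  branch : ∀ n ∈ S.opened ∪ S.closed, Q.Branch I n
  disjoint : ∀ n ∈ S.opened, n ∉ S.closed
  parent : ∀ n ∈ S.opened ∪ S.closed, n.time = 0 ∨ ∃ m ∈ S.closed, n ∈ Q.succ I m
  notGoal : ∀ n ∈ S.closed, ¬ Q.IsGoal I n
  root : ∃ n ∈ S.opened ∪ S.closed, n.time = 0
  cover : ∀ n ∈ S.closed, ∀ m ∈ Q.succ I n, ∃ m' ∈ S.opened ∪ S.closed,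
    m'.time = m.time ∧ m'.vertex = m.vertex

theorem Query.SearchInv.init (Q : Query V k) (I : Instance V k) :
    Q.SearchInv I (Q.init I) where
  branch := by
    rintro n (rfl | h)
    · exact ⟨rfl, fun s hs => absurd hs (Nat.not_lt_zero s),
        fun s hs => absurd hs (Nat.not_lt_zero s),
        fun s hs => absurd hs (Nat.not_lt_zero s), fun s _ => rfl⟩
    · exact h.elim
  disjoint _ _ := id
  parent := by
    rintro n (rfl | h)
    · exact .inl rfl
    · exact h.elim
  notGoal _ h := h.elim
  root := ⟨_, .inl rfl, rfl⟩
  cover _ h := h.elim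

/-- Duplicate elimination preserves only vertex-timestep pairs, not tree nodes, which is why `cover`
and `root` are stated up to the pair. -/
theorem Query.SearchInv.step {Q : Query V k} {I : Instance V k} {P : Params V k}
    {S S' : SearchState V} (hS : Q.SearchInv I S) (h : Q.Step I P S S') : Q.SearchInv I S' := by
  obtain ⟨n, hn, hng, hc, ho, hcov⟩ := h
  have hno : n ∈ S.opened := hn.1.1
  have hnb : Q.Branch I n := hS.branch n (.inl hno)
  have hncl : n ∈ S'.closed := hc ▸ Set.mem_insert n _
  have hsub : S.closed ⊆ S'.closed := hc ▸ Set.subset_insert n _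
  have hcov' : ∀ m ∈ S.opened ∪ S.closed, ∃ m' ∈ S'.opened ∪ S'.closed,
      m'.time = m.time ∧ m'.vertex = m.vertex := by
    rintro m (hm | hm)
    · rcases eq_or_ne m n with rfl | hne
      · exact ⟨m, .inr hncl, rfl, rfl⟩
      · exact hcov m (.inl ⟨hm, hne⟩)
    · exact ⟨m, .inr (hsub hm), rfl, rfl⟩
  constructor
  · rintro m (hm | hm)
    · rcases ho hm with hm | hm
      · exact hS.branch m (.inl hm.1)
      · exact hnb.succ hm
    · rcases hc ▸ hm with rfl | hm
      · exact hnb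
      · exact hS.branch m (.inr hm)
  · intro m hm hmc
    rw [hc] at hmc
    rcases ho hm with hm | hm
    · rcases hmc with rfl | hmc
      · exact hm.2 rfl
      · exact hS.disjoint m hm.1 hmc
    · have ht := Query.time_of_mem_succ hm
      rcases hmc with rfl | hmc
      · omega
      -- A child of `n` that was already expanded would have an expanded parent. Parents are unique,
      -- so this would be `n`, which was still open.
      · rcases hS.parent m (.inr hmc) with h0 | ⟨n', hn', hm'⟩
        · omega
        · obtain rfl := hnb.parent_unique (hS.branch n' (.inr hn')) hm hm'
          exact hS.disjoint n hno hn'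
  · have hold : ∀ m ∈ S.opened ∪ S.closed, m.time = 0 ∨ ∃ m' ∈ S'.closed, m ∈ Q.succ I m' :=
      fun m hm => (hS.parent m hm).imp id fun ⟨m', h, h'⟩ => ⟨m', hsub h, h'⟩
    rintro m (hm | hm)
    · rcases ho hm with hm | hm
      · exact hold m (.inl hm.1)
      · exact .inr ⟨n, hncl, hm⟩
    · rcases hc ▸ hm with rfl | hm
      · exact hold m (.inl hno)
      · exact hold m (.inr hm)
  · intro m hm
    rcases hc ▸ hm with rfl | hm
    · exact hng
    · exact hS.notGoal m hm
  · obtain ⟨m, hm, hm0⟩ := hS.root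
    obtain ⟨m', hm', ht, -⟩ := hcov' m hm
    exact ⟨m', hm', ht.trans hm0⟩
  · intro m hm m' hm'
    rcases hc ▸ hm with rfl | hm
    · exact hcov m' (.inr hm')
    · obtain ⟨m₁, hm₁, ht, hv⟩ := hS.cover m hm m' hm'
      obtain ⟨m₂, hm₂, ht', hv'⟩ := hcov' m₁ hm₁
      exact ⟨m₂, hm₂, ht'.trans ht, hv'.trans hv⟩

/-- `OPEN_L` always contains a node that lies on a given path satisfying the constraints. -/
theorem Query.SearchInv.exists_opened {Q : Query V k} {I : Instance V k} {P : Params V k}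
    {S : SearchState V} (hS : Q.SearchInv I S) (hadm : P.Admissible I) {p : ℕ → V}
    (hp : I.IsPath Q.agent p) (hsat : ∀ ψ ∈ Q.constraints, ψ.Satisfied p) :
    ∃ n ∈ S.opened, Q.f P n ≤ I.pathCost Q.agent p := by
  by_contra! hno
  -- By admissibility, an open node on `p` would have `f`-value at most the cost of `p`.
  have hno' : ∀ t, t ≤ I.pathCost Q.agent p → ∀ n ∈ S.opened, n.time = t → n.vertex ≠ p t := by
    rintro t ht n hn rfl hv
    have := hadm Q.agent Q.constraints p hp hsat n.time ht
    have := hno n hn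
    rw [Query.f, hv] at this
    omega
  -- With no position of `p` open, `cover` propagates expansion along `p` from the root to the
  -- target, where the expanded node would be a goal.
  have hcl : ∀ t, t ≤ I.pathCost Q.agent p → ∃ n ∈ S.closed, n.time = t ∧ n.vertex = p t := by
    intro t
    induction t with
    | zero =>
      intro ht
      obtain ⟨n, hn, h0⟩ := hS.root
      have hv : n.vertex = p 0 := by
        rw [VTNode.vertex, h0, hp.1, (hS.branch n hn).start]
      rcases hn with hn | hn
      · exact absurd hv (hno' 0 ht n hn h0)
      · exact ⟨n, hn, h0, hv⟩
    | succ t ih =>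
      intro ht
      obtain ⟨n, hn, rfl, hv⟩ := ih (by omega)
      have hsucc : n.extend (p (n.time + 1)) ∈ Q.succ I n := by
        refine Query.mem_succ.2 ⟨p (n.time + 1), ?_, fun h => hsat _ h rfl,
          fun h => hsat _ h ⟨hv.symm, rfl⟩, rfl⟩
        rw [hv]
        exact hp.2.1 n.time
      obtain ⟨m, hm, hmt, hmv⟩ := hS.cover n hn _ hsucc
      rw [VTNode.extend_vertex] at hmv
      rcases hm with hm | hm
      · exact absurd hmv (hno' _ ht m hm hmt)
      · exact ⟨m, hm, hmt, hmv⟩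
  obtain ⟨n, hn, ht, hv⟩ := hcl _ le_rfl
  refine hS.notGoal n hn ⟨hv.trans (hp.eq_target le_rfl), fun t ht' h => ?_⟩
  exact hsat _ h (hp.eq_target (ht ▸ ht'.le))

theorem Query.fmin_le {Q : Query V k} {P : Params V k} {S : SearchState V} {n : VTNode V}
    (hn : n ∈ S.opened) : Q.fmin P S ≤ Q.f P n :=
  Nat.sInf_le ⟨n, hn, rfl⟩

theorem Query.SearchInv.fmin_le_pathCost {Q : Query V k} {I : Instance V k} {P : Params V k}
    {S : SearchState V} (hS : Q.SearchInv I S) (hadm : P.Admissible I) {p : ℕ → V}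
    (hp : I.IsPath Q.agent p) (hsat : ∀ ψ ∈ Q.constraints, ψ.Satisfied p) :
    Q.fmin P S ≤ I.pathCost Q.agent p := by
  obtain ⟨n, hn, hf⟩ := hS.exists_opened hadm hp hsat
  exact (Query.fmin_le hn).trans hf

/-- `FOCAL_L` has a top node if the flex is not too small. -/
theorem Query.exists_isTop {Q : Query V k} {P : Params V k} {S : SearchState V}
    (hflex : ∀ m : ℕ, (m : ℝ) ≤ P.w * ((max m Q.lbHat : ℕ) : ℝ) + Q.flex)
    (hS : S.opened.Nonempty) : ∃ n, Q.IsTop P S n := by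
  obtain ⟨n₀, hn₀⟩ := hS
  have hmin : Q.fmin P S ∈ {b | ∃ n ∈ S.opened, Q.f P n = b} :=
    Nat.sInf_mem ⟨_, n₀, hn₀, rfl⟩
  obtain ⟨m, hm, hmf⟩ := hmin
  -- A node of minimal `f`-value is in FOCAL since the threshold is at least `fmin`.
  have hfocal : m ∈ Q.focal P S := by
    refine ⟨hm, ?_⟩
    rw [hmf]
    exact hflex _
  obtain ⟨n, hn, hmin⟩ := exists_minimalFor_of_wellFoundedLT (· ∈ Q.focal P S) Q.x ⟨m, hfocal⟩
  exact ⟨n, hn, fun m hm => (le_total (Q.x n) (Q.x m)).elim id (hmin hm)⟩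

/-- The search can go on or terminates with a path unless `OPEN_L` is empty. -/
theorem Query.step_or_finds {Q : Query V k} (I : Instance V k) {P : Params V k}
    {S : SearchState V}
    (hflex : ∀ m : ℕ, (m : ℝ) ≤ P.w * ((max m Q.lbHat : ℕ) : ℝ) + Q.flex)
    (hS : S.opened.Nonempty) : (∃ S', Q.Step I P S S') ∨ ∃ p b, Q.Finds I P S p b := by
  obtain ⟨n, hn⟩ := Query.exists_isTop hflex hS
  by_cases hg : Q.IsGoal I n
  · exact .inr ⟨_, _, n, hn, hg, rfl, rfl⟩
  -- The step that eliminates no duplicates is always available.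
  · exact .inl ⟨⟨(S.opened \ {n}) ∪ Q.succ I n, insert n S.closed⟩, n, hn, hg, rfl, subset_rfl,
      fun m hm => ⟨m, .inl hm, rfl, rfl⟩⟩

/-- What a successful focal search guarantees. -/
structure Query.Result (Q : Query V k) (I : Instance V k) (P : Params V k) (p : ℕ → V) (b : ℕ) :
    Prop where
  isPath : I.IsPath Q.agent p
  satisfied : ∀ ψ ∈ Q.constraints, ψ.Satisfied p
  cost_le : (I.pathCost Q.agent p : ℝ) ≤ P.w * (b : ℝ) + Q.flex
  lower : ∀ q, I.IsPath Q.agent q → (∀ ψ ∈ Q.constraints, ψ.Satisfied q) →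
    b ≤ max (I.pathCost Q.agent q) Q.lbHat

/-- The goal node is in FOCAL, so its timestep, and with it the path cost, is below the threshold.
For the lower bound, OPEN contains a node on each feasible path. -/
theorem Query.SearchInv.result {Q : Query V k} {I : Instance V k} {P : Params V k}
    {S : SearchState V} (hS : Q.SearchInv I S) (hadm : P.Admissible I)
    (hQ : ∀ ψ ∈ Q.constraints, ψ.Proper) {p : ℕ → V} {b : ℕ} (h : Q.Finds I P S p b) :
    Q.Result I P p b := by
  obtain ⟨n, hn, hg, rfl, rfl⟩ := h
  have hb := hS.branch n (.inl hn.1.1)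
  refine ⟨hb.isPath hg, hb.satisfied hg hQ, le_trans ?_ hn.1.2, fun q hq hsat =>
    max_le_max_right _ (hS.fmin_le_pathCost hadm hq hsat)⟩
  exact_mod_cast (hb.pathCost_le hg).trans (Nat.le_add_right _ _)

/-! ### Termination of the focal search -/

/-- If a feasible path exists, its cost bounds `fmin`, hence the threshold and the timestep of every
top node. If none exists, no branch outlasts the constraints, since it could be completed to a
feasible path. -/
theorem Query.exists_time_bound {Q : Query V k} {I : Instance V k} {P : Params V k}
    (hw : 0 ≤ P.w) (hadm : P.Admissible I) (hQ : ∀ ψ ∈ Q.constraints, ψ.Proper)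
    (hr : I.graph.Reachable (I.start Q.agent) (I.target Q.agent)) :
    ∃ B, ∀ S n, Q.SearchInv I S → Q.IsTop P S n → n.time ≤ B := by
  by_cases hp : ∃ p, I.IsPath Q.agent p ∧ ∀ ψ ∈ Q.constraints, ψ.Satisfied p
  · obtain ⟨p, hp, hsat⟩ := hp
    refine ⟨⌈P.w * ((max (I.pathCost Q.agent p) Q.lbHat : ℕ) : ℝ) + Q.flex⌉₊, fun S n hS hn => ?_⟩
    have h1 : (n.time : ℝ) ≤ Q.f P n := by exact_mod_cast Nat.le_add_right _ _
    have h2 : (Q.f P n : ℝ) ≤ P.w * ((max (Q.fmin P S) Q.lbHat : ℕ) : ℝ) + Q.flex := hn.1.2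
    have h3 : ((max (Q.fmin P S) Q.lbHat : ℕ) : ℝ) ≤
        ((max (I.pathCost Q.agent p) Q.lbHat : ℕ) : ℝ) := by
      exact_mod_cast max_le_max_right _ (hS.fmin_le_pathCost hadm hp hsat)
    have h4 := mul_le_mul_of_nonneg_left h3 hw
    have h5 : (n.time : ℝ) ≤ P.w * ((max (I.pathCost Q.agent p) Q.lbHat : ℕ) : ℝ) + Q.flex := by
      linarith
    exact_mod_cast h5.trans (Nat.le_ceil _)
  · obtain ⟨T, hT⟩ := Constraint.exists_time_lt Q.constraints
    refine ⟨T, fun S n hS hn => ?_⟩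
    by_contra! hlt
    exact hp ((hS.branch n (.inl hn.1.1)).exists_path hQ hr fun ψ hψ => (hT ψ hψ).trans hlt)

/-- There is no infinite focal search if the target is reachable in the graph. -/
theorem Query.SearchInv.acc [Finite V] {Q : Query V k} {I : Instance V k} {P : Params V k}
    (hw : 0 ≤ P.w) (hadm : P.Admissible I) (hQ : ∀ ψ ∈ Q.constraints, ψ.Proper)
    (hr : I.graph.Reachable (I.start Q.agent) (I.target Q.agent)) {S : SearchState V}
    (hS : Q.SearchInv I S) : Acc (fun S' S => Q.Step I P S S') S := by
  obtain ⟨B, hB⟩ := Query.exists_time_bound hw hadm hQ hr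
  have hfin := Q.finite_branch I B
  -- The measure counts the branches within the time bound that are not yet expanded; the top node
  -- is one of them and leaves this set.
  generalize hd : ({n | Q.Branch I n ∧ n.time ≤ B} \ S.closed).ncard = d
  induction d using Nat.strong_induction_on generalizing S with
  | _ d ih =>
    refine ⟨_, fun S' hstep => ih _ ?_ (hS.step hstep) rfl⟩
    obtain ⟨n, hn, -, hc, -, -⟩ := hstep
    rw [← hd, hc]
    refine Set.ncard_lt_ncard ?_ (hfin.subset Set.sdiff_subset)
    refine ⟨Set.sdiff_subset_sdiff_right (Set.subset_insert _ _), fun hsub => ?_⟩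
    have hmem : n ∈ {n | Q.Branch I n ∧ n.time ≤ B} \ S.closed :=
      ⟨⟨hS.branch n (.inl hn.1.1), hB S n hS hn⟩, hS.disjoint n hn.1.1⟩
    exact (hsub hmem).2 (Set.mem_insert _ _)

/-! ### Sums over agents -/

theorem sum_update {α M : Type*} [AddCommMonoid M] (F : Fin k → α → M) (g : Fin k → α) (i : Fin k)
    (a : α) :
    ∑ j, F j (Function.update g i a j) = F i a + ∑ j ∈ Finset.univ.erase i, F j (g j) := by
  rw [← Finset.add_sum_erase _ _ (Finset.mem_univ i), Function.update_self]
  congr 1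
  exact Finset.sum_congr rfl fun j hj => by rw [Function.update_of_ne (Finset.ne_of_mem_erase hj)]

theorem sum_eq_add_sumOthers (i : Fin k) (a : Fin k → ℕ) :
    ((∑ j, a j : ℕ) : ℝ) = a i + sumOthers i a := by
  rw [Nat.cast_sum, ← Finset.add_sum_erase _ _ (Finset.mem_univ i)]
  rfl

theorem soc_replan (I : Instance V k) (N : CTNode V k) (i : Fin k) (Ψ : Finset (Constraint V))
    (p : ℕ → V) (b : ℕ) :
    ((N.replan i Ψ p b).soc I : ℝ) = I.pathCost i p + sumOthers i (N.cost I) := by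
  rw [sumOthers, ← Nat.cast_sum, ← Nat.cast_add, Nat.cast_inj]
  exact sum_update (fun j q => I.pathCost j q) N.path i p

theorem solb_replan (N : CTNode V k) (i : Fin k) (Ψ : Finset (Constraint V))
    (p : ℕ → V) (b : ℕ) :
    ((N.replan i Ψ p b).solb : ℝ) = b + sumOthers i N.lb := by
  rw [sumOthers, ← Nat.cast_sum, ← Nat.cast_add, Nat.cast_inj]
  exact sum_update (fun _ c => c) N.lb i b

theorem maxFlex_eq (I : Instance V k) (P : Params V k) (N : CTNode V k) (i : Fin k) :
    maxFlex I P N i = P.w * sumOthers i N.lb - sumOthers i (N.cost I) := by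
  rw [maxFlex, Finset.sum_sub_distrib, ← Finset.mul_sum]
  rfl

/-! ### Conflicts -/

theorem EdgeConflict.symm {p q : ℕ → V} {t : ℕ} (h : EdgeConflict p q t) : EdgeConflict q p t :=
  ⟨by rw [h.2.1, h.2.2]; exact h.1.symm, h.2.2.symm, h.2.1.symm⟩

theorem numConflicts_comm (p q : ℕ → V) : numConflicts p q = numConflicts q p := by
  have h1 : {t | VertexConflict p q t} = {t | VertexConflict q p t} :=
    Set.ext fun t => ⟨Eq.symm, Eq.symm⟩
  have h2 : {t | EdgeConflict p q t} = {t | EdgeConflict q p t} :=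
    Set.ext fun t => ⟨EdgeConflict.symm, EdgeConflict.symm⟩
  rw [numConflicts, numConflicts, h1, h2]

/-- `totalConflicts` counts each pair in the row of its smaller index: the conflicts of `i` with
larger indices form row `i`, the others are single entries of the rows `j < i`. -/
theorem CTNode.agentConflicts_le (N : CTNode V k) (i : Fin k) :
    N.agentConflicts i ≤ N.totalConflicts := by
  have hsplit : Finset.univ.erase i = Finset.Ioi i ∪ Finset.Iio i := by
    ext j
    simp only [Finset.mem_erase, Finset.mem_univ, and_true, Finset.mem_union, Finset.mem_Ioi,
      Finset.mem_Iio]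
    exact ⟨fun h => (lt_or_gt_of_ne h).symm, fun h => h.elim ne_of_gt ne_of_lt⟩
  have hdisj : Disjoint (Finset.Ioi i) (Finset.Iio i) :=
    Finset.disjoint_left.2 fun j h h' => lt_asymm (Finset.mem_Ioi.1 h) (Finset.mem_Iio.1 h')
  rw [agentConflicts, totalConflicts, hsplit, Finset.sum_union hdisj,
    ← Finset.add_sum_erase _ _ (Finset.mem_univ i)]
  refine Nat.add_le_add_left ?_ _
  calc ∑ j ∈ Finset.Iio i, numConflicts (N.path i) (N.path j)
      ≤ ∑ j ∈ Finset.Iio i, ∑ l ∈ Finset.Ioi j, numConflicts (N.path j) (N.path l) := by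
        refine Finset.sum_le_sum fun j hj => ?_
        rw [numConflicts_comm]
        exact Finset.single_le_sum (f := fun l => numConflicts (N.path j) (N.path l))
          (fun _ _ => Nat.zero_le _) (Finset.mem_Ioi.2 (Finset.mem_Iio.1 hj))
    _ ≤ _ := Finset.sum_le_sum_of_subset fun j hj =>
        Finset.mem_erase.2 ⟨(Finset.mem_Iio.1 hj).ne, Finset.mem_univ _⟩

/-! ### Flex -/

theorem conflictRatio_nonneg (N : CTNode V k) (i : Fin k) : 0 ≤ conflictRatio N i :=
  div_nonneg (Nat.cast_nonneg _) (Nat.cast_nonneg _)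

theorem conflictRatio_le_one (N : CTNode V k) (i : Fin k) : conflictRatio N i ≤ 1 :=
  div_le_one_of_le₀ (Nat.cast_le.2 (N.agentConflicts_le i)) (Nat.cast_nonneg _)

theorem MFD.eq_of_neg {I : Instance V k} {P : Params V k} {L : Multiset (CTNode V k)}
    {N : CTNode V k} {i : Fin k} {ψ : Constraint V} {src : FlexSource V k} {Δ : ℝ}
    (h : MFD I P L N i ψ src Δ) (hneg : maxFlex I P N i < 0) : Δ = maxFlex I P N i := by
  cases h with
  | gfd => rfl
  | dfd h => exact absurd hneg h.not_gt
  | cfd h => exact absurd hneg h.not_gt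
  | front _ _ h => exact absurd hneg h.not_gt
  | zero _ h => exact absurd hneg h.not_gt

/-- With a ratio in `[0, 1]`, the DFD flex is a convex combination of `delayFlex` and `maxFlex`, and
the CFD flex is a fraction of `maxFlex`. In rule 4, the first front condition makes the modified
maximum at most `maxFlex`. -/
theorem MFD.mem_Icc {I : Instance V k} {P : Params V k} {L : Multiset (CTNode V k)}
    {N : CTNode V k} {i : Fin k} {ψ : Constraint V} {src : FlexSource V k} {Δ : ℝ}
    (hw : 0 ≤ P.w) (hdelay : 0 ≤ P.totalDelay N i ψ)
    (h : MFD I P L N i ψ src Δ) (hnonneg : 0 ≤ maxFlex I P N i) :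
    0 ≤ Δ ∧ Δ ≤ maxFlex I P N i := by
  have h0 := conflictRatio_nonneg N i
  have h1 := conflictRatio_le_one N i
  cases h with
  | gfd h => exact absurd h hnonneg.not_gt
  | dfd =>
    have hd0 : 0 ≤ delayFlex I P N i ψ := le_min hnonneg hdelay
    have hd1 : delayFlex I P N i ψ ≤ maxFlex I P N i := min_le_left _ _
    have := mul_nonneg h0 (sub_nonneg.2 hd1)
    have := mul_le_of_le_one_left (sub_nonneg.2 hd1) h1
    rw [dfdFlex]
    constructor <;> linarith
  | cfd => exact ⟨mul_nonneg h0 hnonneg, mul_le_of_le_one_left hnonneg h1⟩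
  | front NF _ _ _ _ _ hcond hΔ0 hΔ =>
    refine ⟨hΔ0, hΔ.trans ?_⟩
    rw [maxFlex_eq, frontMaxFlex]
    exact sub_le_sub_right (mul_le_mul_of_nonneg_left hcond.1.le hw) _
  | zero => exact ⟨le_rfl, hnonneg⟩

theorem MFD.le_maxFlex {I : Instance V k} {P : Params V k} {L : Multiset (CTNode V k)}
    {N : CTNode V k} {i : Fin k} {ψ : Constraint V} {src : FlexSource V k} {Δ : ℝ}
    (hw : 0 ≤ P.w) (hdelay : 0 ≤ P.totalDelay N i ψ)
    (h : MFD I P L N i ψ src Δ) : Δ ≤ maxFlex I P N i := by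
  rcases lt_or_ge (maxFlex I P N i) 0 with hneg | hnonneg
  · exact (h.eq_of_neg hneg).le
  · exact (h.mem_Icc hw hdelay hnonneg).2

theorem exists_mfd (I : Instance V k) (P : Params V k) {L : Multiset (CTNode V k)}
    (hL : ∃ NF, IsFront L NF) (N : CTNode V k) (i : Fin k) (ψ : Constraint V) :
    ∃ src Δ, MFD I P L N i ψ src Δ := by
  obtain ⟨NF, hNF⟩ := hL
  rcases lt_or_ge (maxFlex I P N i) 0 with hneg | hnonneg
  · exact ⟨_, _, .gfd hneg⟩
  by_cases hd : Fits I P L N i (dfdFlex I P N i ψ)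
  · exact ⟨_, _, .dfd hnonneg hd⟩
  by_cases hc : Fits I P L N i (cfdFlex I P N i)
  · exact ⟨_, _, .cfd hnonneg hd hc⟩
  by_cases hcond : FrontConditions I P N NF i
  -- Flex 0 is allowed by the second front condition.
  · exact ⟨_, _, .front NF 0 hnonneg hd hc hNF hcond le_rfl (sub_nonneg.2 hcond.2.le)⟩
  · exact ⟨_, _, .zero NF hnonneg hd hc hNF hcond⟩

/-! ### Nodes of the constraint tree -/

/-- Invariants of the generated CT nodes. -/
structure CTNode.Good (I : Instance V k) (w : ℝ) (N : CTNode V k) : Prop where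
  isPath : ∀ i, I.IsPath i (N.path i)
  satisfied : ∀ i, ∀ ψ ∈ N.constraints i, ψ.Satisfied (N.path i)
  proper : ∀ i, ∀ ψ ∈ N.constraints i, ψ.Proper
  lower : ∀ i q, I.IsPath i q → (∀ ψ ∈ N.constraints i, ψ.Satisfied q) → N.lb i ≤ I.pathCost i q
  bounded : LocallyBounded I w N

theorem CTNode.Good.lb_le_cost {I : Instance V k} {w : ℝ} {N : CTNode V k} (hN : N.Good I w)
    (i : Fin k) : N.lb i ≤ N.cost I i :=
  hN.lower i _ (hN.isPath i) (hN.satisfied i)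

/-- The constraint `ψ` forbids the path of agent `i` in `N`. -/
structure CTNode.Violates (N : CTNode V k) (i : Fin k) (ψ : Constraint V) : Prop where
  proper : ψ.Proper
  not_satisfied : ¬ ψ.Satisfied (N.path i)

/-- Distinct starts rule out a vertex conflict at timestep 0, and an edge conflict involves genuine
moves, so the new constraints are proper. -/
theorem Resolves.violates {I : Instance V k} {N : CTNode V k} (hN : ∀ i, I.IsPath i (N.path i))
    {a b : Fin k × Constraint V} (h : Resolves N a b) :
    N.Violates a.1 a.2 ∧ N.Violates b.1 b.2 := by
  cases h with
  | vertex i j t hij h =>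
    have ht : 0 < t := by
      rcases Nat.eq_zero_or_pos t with rfl | ht
      · refine absurd (I.start_injective ?_) hij
        rw [← (hN i).1, ← (hN j).1]
        exact h
      · exact ht
    exact ⟨⟨ht, fun h => h rfl⟩, ⟨ht, fun h => h rfl⟩⟩
  | edge i j t hij h =>
    exact ⟨⟨h.1, fun h => h ⟨rfl, rfl⟩⟩, ⟨h.symm.1, fun h => h ⟨rfl, rfl⟩⟩⟩

theorem CTNode.mem_childConstraints {N : CTNode V k} {i : Fin k} {ψ φ : Constraint V} :
    φ ∈ N.childConstraints i ψ ↔ φ = ψ ∨ φ ∈ N.constraints i := by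
  classical
  exact Finset.mem_insert

theorem CTNode.Good.childQuery_proper {I : Instance V k} {w : ℝ} {N : CTNode V k}
    (hN : N.Good I w) {i : Fin k} {ψ : Constraint V} (hψ : ψ.Proper) (Δ : ℝ) :
    ∀ φ ∈ (childQuery N i ψ Δ).constraints, φ.Proper := by
  intro φ hφ
  rcases CTNode.mem_childConstraints.1 hφ with rfl | hφ
  · exact hψ
  · exact hN.proper i φ hφ

/-- If the flex is at most the maximum allowed flex then the child is locally bounded-suboptimal
and inherits all other invariants. -/
theorem CTNode.Good.child {I : Instance V k} {P : Params V k} {N : CTNode V k}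
    (hN : N.Good I P.w) {i : Fin k} {ψ : Constraint V} (hψ : ψ.Proper) {Δ : ℝ}
    (hΔ : Δ ≤ maxFlex I P N i) {p : ℕ → V} {b : ℕ}
    (h : (childQuery N i ψ Δ).Result I P p b) :
    (N.replan i (N.childConstraints i ψ) p b).Good I P.w := by
  have key : ∀ j, j = i ∨ (j ≠ i ∧
      (N.replan i (N.childConstraints i ψ) p b).path j = N.path j ∧
      (N.replan i (N.childConstraints i ψ) p b).constraints j = N.constraints j ∧
      (N.replan i (N.childConstraints i ψ) p b).lb j = N.lb j) := fun j =>
    or_iff_not_imp_left.2 fun hj => ⟨hj, Function.update_of_ne hj _ _,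
      Function.update_of_ne hj _ _, Function.update_of_ne hj _ _⟩
  have hp : (N.replan i (N.childConstraints i ψ) p b).path i = p := Function.update_self _ _ _
  have hc : (N.replan i (N.childConstraints i ψ) p b).constraints i = N.childConstraints i ψ :=
    Function.update_self _ _ _
  have hb : (N.replan i (N.childConstraints i ψ) p b).lb i = b := Function.update_self _ _ _
  constructor
  · intro j
    rcases key j with rfl | ⟨-, h1, -, -⟩
    · rw [hp]
      exact h.isPath
    · rw [h1]
      exact hN.isPath j
  · intro j
    rcases key j with rfl | ⟨-, h1, h2, -⟩
    · rw [hp, hc]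
      exact h.satisfied
    · rw [h1, h2]
      exact hN.satisfied j
  · intro j
    rcases key j with rfl | ⟨-, -, h2, -⟩
    · rw [hc]
      exact hN.childQuery_proper hψ Δ
    · rw [h2]
      exact hN.proper j
  · intro j q hq
    rcases key j with rfl | ⟨-, -, h2, h3⟩
    · rw [hc, hb]
      intro hsat
      -- A path feasible for the child is feasible for the parent, so the inherited bound stays
      -- valid.
      exact (h.lower q hq hsat).trans (max_le le_rfl (hN.lower j q hq fun φ hφ =>
        hsat φ (CTNode.mem_childConstraints.2 (.inr hφ))))
    · rw [h2, h3]
      exact hN.lower j q hq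
  · have hcost := h.cost_le
    rw [maxFlex_eq] at hΔ
    rw [LocallyBounded, soc_replan, solb_replan]
    have : (I.pathCost i p : ℝ) ≤ P.w * b + Δ := hcost
    linarith

/-- The threshold of the focal search for a child is at least `f_min`. -/
theorem CTNode.Good.le_threshold {I : Instance V k} {P : Params V k} {N : CTNode V k}
    (hN : N.Good I P.w) (hw : 1 ≤ P.w) {i : Fin k} {Δ : ℝ}
    (h : 0 ≤ Δ ∨ Δ = maxFlex I P N i) (m : ℕ) :
    (m : ℝ) ≤ P.w * ((max m (N.lb i) : ℕ) : ℝ) + Δ := by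
  have hw0 : 0 ≤ P.w := zero_le_one.trans hw
  rcases h with h | rfl
  · have h1 : (m : ℝ) ≤ ((max m (N.lb i) : ℕ) : ℝ) := by exact_mod_cast le_max_left _ _
    have h2 := le_mul_of_one_le_left (Nat.cast_nonneg (α := ℝ) (max m (N.lb i))) hw
    linarith
  -- Local boundedness reads `w * lb i + maxFlex ≥ cost i ≥ lb i`. Raising `lb i` to a larger `m`
  -- adds `w * (m - lb i) ≥ m - lb i` on the left.
  · have hlc : (N.lb i : ℝ) ≤ N.cost I i := by exact_mod_cast hN.lb_le_cost i
    have hb : (N.soc I : ℝ) ≤ P.w * (N.solb : ℝ) := hN.bounded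
    rw [CTNode.soc, CTNode.solb, sum_eq_add_sumOthers i, sum_eq_add_sumOthers i] at hb
    rw [maxFlex_eq]
    rcases le_total m (N.lb i) with hm | hm
    · rw [max_eq_right hm]
      have : (m : ℝ) ≤ N.lb i := by exact_mod_cast hm
      linarith
    · rw [max_eq_left hm]
      have : (N.lb i : ℝ) ≤ m := by exact_mod_cast hm
      nlinarith

theorem MFD.le_threshold {I : Instance V k} {P : Params V k} {L : Multiset (CTNode V k)}
    {N : CTNode V k} {i : Fin k} {ψ : Constraint V} {src : FlexSource V k} {Δ : ℝ}
    (h : MFD I P L N i ψ src Δ) (hw : 1 ≤ P.w) (hdelay : 0 ≤ P.totalDelay N i ψ)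
    (hN : N.Good I P.w) (m : ℕ) : (m : ℝ) ≤ P.w * ((max m (N.lb i) : ℕ) : ℝ) + Δ := by
  refine hN.le_threshold hw ?_ m
  rcases lt_or_ge (maxFlex I P N i) 0 with hneg | hnonneg
  · exact .inr (h.eq_of_neg hneg)
  · exact .inl (h.mem_Icc (zero_le_one.trans hw) hdelay hnonneg).1

/-- A child with flex from the rule `front` is globally bounded-suboptimal if the lower bound of
the replanned agent is that of the front node. -/
theorem globallyBounded_of_front {I : Instance V k} {P : Params V k} {L : Multiset (CTNode V k)}
    {N NF : CTNode V k} {i : Fin k} {ψ : Constraint V} {Δ : ℝ} {p : ℕ → V} {b : ℕ}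
    (h : MFD I P L N i ψ (.front NF) Δ) (hp : (childQuery N i ψ Δ).Result I P p b)
    (hb : b = NF.lb i) :
    GloballyBounded I P.w L (N.replan i (N.childConstraints i ψ) p b) := by
  cases h with
  | front _ _ _ _ _ hNF _ _ hΔ =>
    have hcost : (I.pathCost i p : ℝ) ≤ P.w * b + Δ := hp.cost_le
    -- `LB` is the SOLB of `NF`, that is `b` plus the bounds of the other agents in `NF`; the costs
    -- of the other agents cancel against the flex.
    rw [GloballyBounded, soc_replan, ← hNF.2, CTNode.solb, sum_eq_add_sumOthers i, ← hb]
    rw [frontMaxFlex] at hΔ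
    linarith

theorem exists_isFront {L : Multiset (CTNode V k)} (hL : ∃ N, N ∈ L) : ∃ NF, IsFront L NF := by
  obtain ⟨N, hN⟩ := hL
  exact Nat.sInf_mem (s := {b | ∃ N ∈ L, N.solb = b}) ⟨_, N, hN, rfl⟩

/-! ### Invariants of EECBS -/

/-- The agents with index below `m` have been planned in the root. -/
structure CTNode.RootGood (I : Instance V k) (w : ℝ) (m : ℕ) (N : CTNode V k) : Prop where
  le : m ≤ k
  constraints : ∀ i, N.constraints i = ∅
  isPath : ∀ i : Fin k, (i : ℕ) < m → I.IsPath i (N.path i)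
  lower : ∀ i : Fin k, (i : ℕ) < m → ∀ q, I.IsPath i q → N.lb i ≤ I.pathCost i q
  cost_le : ∀ i : Fin k, (i : ℕ) < m → (N.cost I i : ℝ) ≤ w * (N.lb i : ℝ)

theorem CTNode.RootGood.good {I : Instance V k} {w : ℝ} {N : CTNode V k}
    (h : N.RootGood I w k) : N.Good I w where
  isPath i := h.isPath i i.2
  satisfied i ψ hψ := by simp [h.constraints i] at hψ
  proper i ψ hψ := by simp [h.constraints i] at hψ
  lower i q hq _ := h.lower i i.2 q hq
  bounded := by
    rw [LocallyBounded, soc, solb, Nat.cast_sum, Nat.cast_sum, Finset.mul_sum]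
    exact Finset.sum_le_sum fun i _ => h.cost_le i i.2

/-- Zero flex gives the bound agent by agent, and the inherited bound 0 does not affect the maximum.
-/
theorem CTNode.RootGood.replan {I : Instance V k} {P : Params V k} {N : CTNode V k} {i : Fin k}
    (h : N.RootGood I P.w i) {p : ℕ → V} {b : ℕ} (hp : (rootQuery N i).Result I P p b) :
    (N.replan i ∅ p b).RootGood I P.w (i + 1) := by
  have key : ∀ j : Fin k, (j : ℕ) < i + 1 → j = i ∨ ((j : ℕ) < i ∧
      (N.replan i ∅ p b).path j = N.path j ∧ (N.replan i ∅ p b).lb j = N.lb j) := by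
    intro j hj
    rcases eq_or_ne j i with rfl | hne
    · exact .inl rfl
    · have := Fin.val_ne_of_ne hne
      exact .inr ⟨by omega, Function.update_of_ne hne _ _, Function.update_of_ne hne _ _⟩
  have hpi : (N.replan i ∅ p b).path i = p := Function.update_self _ _ _
  have hbi : (N.replan i ∅ p b).lb i = b := Function.update_self _ _ _
  constructor
  · exact i.2
  · intro j
    rcases eq_or_ne j i with rfl | hne
    · exact Function.update_self _ _ _
    · exact (Function.update_of_ne hne _ _).trans (h.constraints j)
  · intro j hj
    rcases key j hj with rfl | ⟨hlt, h1, -⟩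
    · rw [hpi]
      exact hp.isPath
    · rw [h1]
      exact h.isPath j hlt
  · intro j hj q hq
    rcases key j hj with rfl | ⟨hlt, -, h2⟩
    · rw [hbi]
      exact (hp.lower q hq fun ψ hψ => by simp [rootQuery] at hψ).trans
        (max_le le_rfl (Nat.zero_le _))
    · rw [h2]
      exact h.lower j hlt q hq
  · intro j hj
    rcases key j hj with rfl | ⟨hlt, h1, h2⟩
    · rw [CTNode.cost, hbi, hpi]
      have := hp.cost_le
      rwa [rootQuery, add_zero] at this
    · rw [CTNode.cost, h1, h2]
      exact h.cost_le j hlt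

/-- The node `Nhat` of LISTs `L` is being expanded. -/
structure ExpandInv (I : Instance V k) (w : ℝ) (L : Multiset (CTNode V k)) (Nhat : CTNode V k)
    (pending : List (Fin k × Constraint V)) : Prop where
  mem : Nhat ∈ L
  good : ∀ N ∈ L, N.Good I w
  violates : ∀ a ∈ pending, Nhat.Violates a.1 a.2

/-- Invariants of EECBS with MFD. -/
def Config.Inv (I : Instance V k) (P : Params V k) : Config V k → Prop
  | .root m N => N.RootGood I P.w m
  | .rootSearch i N S => N.RootGood I P.w i ∧ (rootQuery N i).SearchInv I S
  | .select L => ∀ N ∈ L, N.Good I P.w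
  | .expand L Nhat pending => ExpandInv I P.w L Nhat pending
  | .search L Nhat i ψ src Δ S pending => ExpandInv I P.w L Nhat ((i, ψ) :: pending) ∧
      MFD I P L Nhat i ψ src Δ ∧ (childQuery Nhat i ψ Δ).SearchInv I S
  | .returned N => N.Good I P.w ∧ ConflictFree N.path
  | .failed => True

theorem rootQuery_proper (N : CTNode V k) (i : Fin k) :
    ∀ ψ ∈ (rootQuery N i).constraints, ψ.Proper := fun ψ hψ => by simp [rootQuery] at hψ

theorem Config.Inv.init (I : Instance V k) (P : Params V k) : (Config.init I).Inv I P where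
  le := Nat.zero_le _
  constraints _ := rfl
  isPath _ h := absurd h (Nat.not_lt_zero _)
  lower _ h := absurd h (Nat.not_lt_zero _)
  cost_le _ h := absurd h (Nat.not_lt_zero _)

theorem Config.Inv.step {I : Instance V k} {P : Params V k} (hw : 1 ≤ P.w)
    (hadm : P.Admissible I) (hdelay : ∀ N i ψ, 0 ≤ P.totalDelay N i ψ) {c c' : Config V k}
    (hc : c.Inv I P) (h : Step I P c c') : c'.Inv I P := by
  cases h with
  | rootNext N i => exact ⟨hc, Query.SearchInv.init _ _⟩
  | rootStep i N S S' h => exact ⟨hc.1, hc.2.step h⟩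
  | rootFound i N S p b h => exact hc.1.replan (hc.2.result hadm (rootQuery_proper N i) h)
  | rootNoPath => trivial
  | rootDone N =>
    intro N' hN'
    rw [Multiset.mem_singleton.1 hN']
    exact CTNode.RootGood.good hc
  | noNode => trivial
  | solved L N hmem hgb hfree => exact ⟨hc N hmem, hfree⟩
  | split L N a b hmem hgb hres =>
    have hv := hres.violates (hc N hmem).isPath
    refine ⟨hmem, hc, fun d hd => ?_⟩
    rcases List.mem_cons.1 hd with rfl | hd
    · exact hv.1
    · rw [List.mem_singleton.1 hd]
      exact hv.2
  | childStart L N i ψ pending src Δ h => exact ⟨hc, h, Query.SearchInv.init _ _⟩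
  | childStep L N i ψ src Δ S S' pending h => exact ⟨hc.1, hc.2.1, hc.2.2.step h⟩
  | childFound L N i ψ src Δ S pending p b h =>
    obtain ⟨hE, hM, hS⟩ := hc
    have hN := hE.good N hE.mem
    have hψ := (hE.violates _ List.mem_cons_self).proper
    refine ⟨Multiset.mem_cons_of_mem hE.mem, fun N' hN' => ?_,
      fun a ha => hE.violates a (List.mem_cons_of_mem _ ha)⟩
    rcases Multiset.mem_cons.1 hN' with rfl | hN'
    · exact hN.child hψ (hM.le_maxFlex (zero_le_one.trans hw) (hdelay _ _ _))
        (hS.result hadm (hN.childQuery_proper hψ Δ) h)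
    · exact hE.good N' hN'
  | childNoPath L N i ψ src Δ S pending h =>
    exact ⟨hc.1.mem, hc.1.good, fun a ha => hc.1.violates a (List.mem_cons_of_mem _ ha)⟩
  | expandDone L N => exact fun N' hN' => hc.good N' (Multiset.mem_cons_of_mem hN')

theorem Reachable.inv {I : Instance V k} {P : Params V k} (hw : 1 ≤ P.w)
    (hadm : P.Admissible I) (hdelay : ∀ N i ψ, 0 ≤ P.totalDelay N i ψ) {c : Config V k}
    (hc : Reachable I P c) : c.Inv I P := by
  induction hc with
  | refl => exact Config.Inv.init I P
  | tail _ h ih => exact ih.step hw hadm hdelay h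

/-! ### Invariants relative to a solution -/

/-- The paths `R` satisfy all constraints of `N`. -/
def CTNode.Permits (N : CTNode V k) (R : Fin k → ℕ → V) : Prop :=
  ∀ i, ∀ ψ ∈ N.constraints i, ψ.Satisfied (R i)

/-- All constraints of `N` are at timesteps up to `B`. -/
def CTNode.Early (B : ℕ) (N : CTNode V k) : Prop :=
  ∀ i, ∀ ψ ∈ N.constraints i, ψ.time ≤ B

theorem CTNode.Early.replan {B : ℕ} {N : CTNode V k} (h : N.Early B) {i : Fin k}
    {ψ : Constraint V} (hψ : ψ.time ≤ B) (p : ℕ → V) (b : ℕ) :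
    (N.replan i (N.childConstraints i ψ) p b).Early B := by
  intro j φ hφ
  rcases eq_or_ne j i with rfl | hne
  · have hφ' : φ ∈ N.childConstraints j ψ := by simpa [CTNode.replan] using hφ
    rcases CTNode.mem_childConstraints.1 hφ' with rfl | h'
    · exact hψ
    · exact h j φ h'
  · exact h j φ (by simpa [CTNode.replan, hne] using hφ)

theorem CTNode.Permits.childQuery {N : CTNode V k} {R : Fin k → ℕ → V} (h : N.Permits R)
    {i : Fin k} {ψ : Constraint V} (hψ : ψ.Satisfied (R i)) (Δ : ℝ) :
    ∀ φ ∈ (childQuery N i ψ Δ).constraints, φ.Satisfied (R i) := by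
  intro φ hφ
  rcases CTNode.mem_childConstraints.1 hφ with rfl | hφ
  · exact hψ
  · exact h i φ hφ

theorem CTNode.Permits.replan {N : CTNode V k} {R : Fin k → ℕ → V} (h : N.Permits R)
    {i : Fin k} {ψ : Constraint V} (hψ : ψ.Satisfied (R i)) (p : ℕ → V) (b : ℕ) :
    (N.replan i (N.childConstraints i ψ) p b).Permits R := by
  intro j φ hφ
  rcases eq_or_ne j i with rfl | hne
  -- The flex 0 is a dummy: the constraints of the query do not depend on it.
  · exact h.childQuery hψ 0 φ (by simpa [CTNode.replan, EECBS.childQuery] using hφ)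
  · exact h j φ (by simpa [CTNode.replan, hne] using hφ)

/-- If `R` violated both constraints, its paths would have the very conflict being resolved. -/
theorem Resolves.satisfied {N : CTNode V k} {a b : Fin k × Constraint V} (h : Resolves N a b)
    {R : Fin k → ℕ → V} (hR : ConflictFree R) :
    a.2.Satisfied (R a.1) ∨ b.2.Satisfied (R b.1) := by
  by_contra! hcon
  obtain ⟨ha, hb⟩ := hcon
  cases h with
  | vertex i j t hij h =>
    exact (hR i j hij t).1 ((not_not.1 ha).trans (h.trans (not_not.1 hb).symm))
  | edge i j t hij h =>
    obtain ⟨ha1, ha2⟩ := not_not.1 ha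
    obtain ⟨hb1, hb2⟩ := not_not.1 hb
    refine (hR i j hij t).2 ⟨?_, ?_, ?_⟩
    · rw [ha1, ha2]
      exact h.1
    · rw [hb1, ha2]
      exact h.2.1
    · rw [hb2, ha1]
      exact h.2.2

theorem exists_resolves {N : CTNode V k} (h : ¬ ConflictFree N.path) : ∃ a b, Resolves N a b := by
  unfold ConflictFree at h
  push Not at h
  obtain ⟨i, j, hij, t, h⟩ := h
  by_cases hv : VertexConflict (N.path i) (N.path j) t
  · exact ⟨_, _, .vertex i j t hij hv⟩
  · exact ⟨_, _, .edge i j t hij (h hv)⟩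

theorem CTNode.cost_le_soc (I : Instance V k) (N : CTNode V k) (i : Fin k) :
    N.cost I i ≤ N.soc I :=
  Finset.single_le_sum (f := N.cost I) (fun _ _ => Nat.zero_le _) (Finset.mem_univ i)

/-- Conflicts occur before all agents have reached their targets. -/
theorem Resolves.time_le {I : Instance V k} {N : CTNode V k} (hN : ∀ i, I.IsPath i (N.path i))
    {a b : Fin k × Constraint V} (h : Resolves N a b) :
    a.2.time ≤ N.soc I ∧ b.2.time ≤ N.soc I := by
  -- From timestep `N.soc I` on, all agents rest at their distinct targets.
  have htarget : ∀ i t, N.soc I ≤ t → N.path i t = I.target i := fun i t ht =>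
    (hN i).eq_target ((N.cost_le_soc I i).trans ht)
  cases h with
  | vertex i j t hij h =>
    have ht : t ≤ N.soc I := by
      by_contra! ht
      refine hij (I.target_injective ?_)
      rw [← htarget i t ht.le, ← htarget j t ht.le]
      exact h
    exact ⟨ht, ht⟩
  | edge i j t hij h =>
    have ht : t ≤ N.soc I := by
      by_contra! ht
      exact h.1 (by rw [htarget i t ht.le, htarget i (t + 1) (by omega)])
    exact ⟨ht, ht⟩

theorem globalLB_le_solb {L : Multiset (CTNode V k)} {N : CTNode V k} (hN : N ∈ L) :
    globalLB L ≤ N.solb :=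
  Nat.sInf_le ⟨N, hN, rfl⟩

theorem globalLB_le_soc {I : Instance V k} {w : ℝ} {L : Multiset (CTNode V k)}
    {R : Fin k → ℕ → V} (hR : I.IsSolution R) {N : CTNode V k} (hN : N ∈ L) (hgood : N.Good I w)
    (hperm : N.Permits R) : globalLB L ≤ I.soc R :=
  (globalLB_le_solb hN).trans
    (Finset.sum_le_sum fun i _ => hgood.lower i (R i) (hR.1 i) (hperm i))

/-- The node `Nhat` of LISTs `L` is being expanded; some node that permits `R` is in LISTs besides
`Nhat` or still to be generated. -/
structure ExpandLive (B : ℕ) (R : Fin k → ℕ → V) (L : Multiset (CTNode V k)) (Nhat : CTNode V k)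
    (pending : List (Fin k × Constraint V)) : Prop where
  early : ∀ N ∈ L, N.Early B
  time_le : ∀ a ∈ pending, a.2.time ≤ B
  permits : ∃ L', L = Nhat ::ₘ L' ∧ ((∃ N ∈ L', N.Permits R) ∨
    (Nhat.Permits R ∧ ∃ a ∈ pending, a.2.Satisfied (R a.1)))

/-- Invariants of EECBS relative to a solution `R`. -/
def Config.Live (I : Instance V k) (P : Params V k) (R : Fin k → ℕ → V) : Config V k → Prop
  | .root _ _ => True
  | .rootSearch _ _ _ => True
  | .select L => (∃ N ∈ L, N.Permits R) ∧ ∀ N ∈ L, N.Early ⌊P.w * I.soc R⌋₊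
  | .expand L Nhat pending => ExpandLive ⌊P.w * I.soc R⌋₊ R L Nhat pending
  | .search L Nhat i ψ _ _ _ pending => ExpandLive ⌊P.w * I.soc R⌋₊ R L Nhat ((i, ψ) :: pending)
  | .returned N => (N.soc I : ℝ) ≤ P.w * I.soc R
  | .failed => False

theorem Config.Live.step {I : Instance V k} {P : Params V k} (hw : 0 ≤ P.w)
    (hadm : P.Admissible I) {R : Fin k → ℕ → V} (hR : I.IsSolution R) {c c' : Config V k}
    (hc : c.Inv I P) (hlive : c.Live I P R) (h : Step I P c c') : c'.Live I P R := by
  -- A node permitting `R` has SOLB at most the SOC of `R`, which therefore bounds `LB`.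
  have hgb : ∀ {L : Multiset (CTNode V k)} {N : CTNode V k}, (∀ N ∈ L, N.Good I P.w) →
      (∃ N ∈ L, N.Permits R) → GloballyBounded I P.w L N → (N.soc I : ℝ) ≤ P.w * I.soc R := by
    rintro L N hgood ⟨N', hN', hperm⟩ hgb
    refine le_trans hgb (mul_le_mul_of_nonneg_left ?_ hw)
    exact_mod_cast globalLB_le_soc hR hN' (hgood N' hN') hperm
  cases h with
  | rootNext N i => trivial
  | rootStep i N S S' h => trivial
  | rootFound i N S p b h => trivial
  | rootNoPath i N S h =>
    obtain ⟨n, hn, -⟩ := hc.2.exists_opened hadm (hR.1 i) fun ψ hψ => by simp [rootQuery] at hψ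
    rw [h] at hn
    exact hn
  | rootDone N =>
    refine ⟨⟨N, Multiset.mem_singleton_self N, fun i ψ hψ => ?_⟩, fun N' hN' i ψ hψ => ?_⟩
    · simp [hc.constraints i] at hψ
    · rw [Multiset.mem_singleton.1 hN', hc.constraints i] at hψ
      simp at hψ
  | noNode =>
    obtain ⟨⟨N, hN, -⟩, -⟩ := hlive
    exact Multiset.notMem_zero _ hN
  | solved L N hmem hN hfree => exact hgb hc hlive.1 hN
  | split L N a b hmem hN hres =>
    have ht := hres.time_le (hc N hmem).isPath
    have hB : N.soc I ≤ ⌊P.w * I.soc R⌋₊ := Nat.le_floor (hgb hc hlive.1 hN)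
    refine ⟨hlive.2, fun d hd => ?_, ?_⟩
    · rcases List.mem_cons.1 hd with rfl | hd
      · exact ht.1.trans hB
      · rw [List.mem_singleton.1 hd]
        exact ht.2.trans hB
    · obtain ⟨L', rfl⟩ := Multiset.exists_cons_of_mem hmem
      obtain ⟨⟨N', hN', hperm⟩, -⟩ := hlive
      refine ⟨L', rfl, ?_⟩
      rcases Multiset.mem_cons.1 hN' with rfl | hN'
      · refine .inr ⟨hperm, ?_⟩
        rcases hres.satisfied hR.2 with h | h
        · exact ⟨a, List.mem_cons_self, h⟩
        · exact ⟨b, List.mem_cons_of_mem _ List.mem_cons_self, h⟩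
      · exact .inl ⟨N', hN', hperm⟩
  | childStart L N i ψ pending src Δ h => exact hlive
  | childStep L N i ψ src Δ S S' pending h => exact hlive
  | childFound L N i ψ src Δ S pending p b h =>
    have hE : ExpandLive ⌊P.w * I.soc R⌋₊ R L N ((i, ψ) :: pending) := hlive
    obtain ⟨L', hL', hperm⟩ := hE.permits
    refine ⟨fun N' hN' => ?_, fun a ha => hE.time_le a (List.mem_cons_of_mem _ ha),
      N.replan i (N.childConstraints i ψ) p b ::ₘ L', by rw [hL', Multiset.cons_swap], ?_⟩
    · rcases Multiset.mem_cons.1 hN' with rfl | hN'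
      · exact (hE.early N hc.1.mem).replan (hE.time_le _ List.mem_cons_self) p b
      · exact hE.early N' hN'
    · rcases hperm with ⟨N', hN', hperm⟩ | ⟨hperm, a, ha, hsat⟩
      · exact .inl ⟨N', Multiset.mem_cons_of_mem hN', hperm⟩
      · rcases List.mem_cons.1 ha with rfl | ha
        · exact .inl ⟨_, Multiset.mem_cons_self _ _, hperm.replan hsat p b⟩
        · exact .inr ⟨hperm, a, ha, hsat⟩
  | childNoPath L N i ψ src Δ S pending h =>
    have hE : ExpandLive ⌊P.w * I.soc R⌋₊ R L N ((i, ψ) :: pending) := hlive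
    obtain ⟨L', hL', hperm⟩ := hE.permits
    refine ⟨hE.early, fun a ha => hE.time_le a (List.mem_cons_of_mem _ ha), L', hL', ?_⟩
    rcases hperm with hperm | ⟨hperm, a, ha, hsat⟩
    · exact .inl hperm
    · rcases List.mem_cons.1 ha with rfl | ha
      -- The path of `R` is feasible for this child, so OPEN cannot be empty.
      · obtain ⟨n, hn, -⟩ := hc.2.2.exists_opened hadm (hR.1 i) (hperm.childQuery hsat Δ)
        rw [h] at hn
        exact hn.elim
      · exact .inr ⟨hperm, a, ha, hsat⟩
  | expandDone L N =>
    have hE : ExpandLive ⌊P.w * I.soc R⌋₊ R (N ::ₘ L) N [] := hlive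
    obtain ⟨L', hL', hperm⟩ := hE.permits
    obtain rfl := (Multiset.cons_inj_right N).1 hL'
    -- Nothing is pending, so the permitting node is in LISTs besides `N`.
    refine ⟨hperm.resolve_right ?_, fun N' hN' => hE.early N' (Multiset.mem_cons_of_mem hN')⟩
    rintro ⟨-, a, ha, -⟩
    exact List.not_mem_nil ha

theorem Reachable.live {I : Instance V k} {P : Params V k} (hw : 1 ≤ P.w)
    (hadm : P.Admissible I) (hdelay : ∀ N i ψ, 0 ≤ P.totalDelay N i ψ) {R : Fin k → ℕ → V}
    (hR : I.IsSolution R) {c : Config V k} (hc : Reachable I P c) : c.Live I P R := by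
  induction hc with
  | refl => trivial
  | tail hc h ih =>
    exact ih.step (zero_le_one.trans hw) hadm hR (Reachable.inv hw hadm hdelay hc) h

/-! ### Progress -/

/-- On a solvable instance, the algorithm can only stop by returning a solution. -/
theorem Config.Live.progress {I : Instance V k} {P : Params V k} (hw : 1 ≤ P.w)
    (hdelay : ∀ N i ψ, 0 ≤ P.totalDelay N i ψ) {R : Fin k → ℕ → V} {c : Config V k}
    (hc : c.Inv I P) (hlive : c.Live I P R) : (∃ c', Step I P c c') ∨ ∃ N, c = .returned N := by
  cases c with
  | root m N =>
    left
    rcases Nat.lt_or_eq_of_le hc.le with hm | rfl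
    · exact ⟨_, .rootNext N ⟨m, hm⟩⟩
    · exact ⟨_, .rootDone N⟩
  | rootSearch i N S =>
    left
    rcases S.opened.eq_empty_or_nonempty with h | h
    · exact ⟨_, .rootNoPath i N S h⟩
    · have hflex : ∀ m : ℕ, (m : ℝ) ≤
          P.w * ((max m (rootQuery N i).lbHat : ℕ) : ℝ) + (rootQuery N i).flex := by
        intro m
        have : (m : ℝ) ≤ P.w * m := le_mul_of_one_le_left (Nat.cast_nonneg m) hw
        simpa [rootQuery] using this
      rcases Query.step_or_finds I hflex h with ⟨S', h⟩ | ⟨p, b, h⟩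
      · exact ⟨_, .rootStep i N S S' h⟩
      · exact ⟨_, .rootFound i N S p b h⟩
  | select L =>
    left
    obtain ⟨N, hN, -⟩ := hlive.1
    obtain ⟨NF, hNF, hLB⟩ := exists_isFront ⟨N, hN⟩
    -- For a front node, local and global boundedness coincide, so some node can always be selected.
    have hgb : GloballyBounded I P.w L NF := by
      rw [GloballyBounded, ← hLB]
      exact (hc NF hNF).bounded
    by_cases hfree : ConflictFree NF.path
    · exact ⟨_, .solved L NF hNF hgb hfree⟩
    · obtain ⟨a, b, hres⟩ := exists_resolves hfree
      exact ⟨_, .split L NF a b hNF hgb hres⟩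
  | expand L N pending =>
    left
    have hmem : N ∈ L := hc.mem
    cases pending with
    | nil =>
      obtain ⟨L', rfl⟩ := Multiset.exists_cons_of_mem hmem
      exact ⟨_, .expandDone L' N⟩
    | cons a pending =>
      obtain ⟨src, Δ, h⟩ := exists_mfd I P (exists_isFront ⟨N, hmem⟩) N a.1 a.2
      exact ⟨_, .childStart L N a.1 a.2 pending src Δ h⟩
  | search L N i ψ src Δ S pending =>
    left
    rcases S.opened.eq_empty_or_nonempty with h | h
    · exact ⟨_, .childNoPath L N i ψ src Δ S pending h⟩
    · obtain ⟨hE, hM, hS⟩ := hc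
      rcases Query.step_or_finds (Q := childQuery N i ψ Δ) I
        (hM.le_threshold hw (hdelay _ _ _) (hE.good N hE.mem)) h with ⟨S', h⟩ | ⟨p, b, h⟩
      · exact ⟨_, .childStep L N i ψ src Δ S S' pending h⟩
      · exact ⟨_, .childFound L N i ψ src Δ S pending p b h⟩
  | returned N => exact .inr ⟨N, rfl⟩
  | failed => exact hlive.elim

/-! ### Termination -/

/-- The total number of constraints. -/
def CTNode.size (N : CTNode V k) : ℕ := ∑ i, (N.constraints i).card

/-- The path of agent `i` satisfies all old constraints and violates `ψ`, so `ψ` is new. -/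
theorem CTNode.Good.size_replan {I : Instance V k} {w : ℝ} {N : CTNode V k} (hN : N.Good I w)
    {i : Fin k} {ψ : Constraint V} (hψ : N.Violates i ψ) (p : ℕ → V) (b : ℕ) :
    (N.replan i (N.childConstraints i ψ) p b).size = N.size + 1 := by
  classical
  have hmem : ψ ∉ N.constraints i := fun h => hψ.not_satisfied (hN.satisfied i ψ h)
  have hcard : (N.childConstraints i ψ).card = (N.constraints i).card + 1 := by
    rw [← Finset.card_insert_of_notMem hmem]
    congr!
  have h1 : (N.replan i (N.childConstraints i ψ) p b).size = (N.childConstraints i ψ).card +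
      ∑ j ∈ Finset.univ.erase i, (N.constraints j).card :=
    sum_update (fun _ Ψ => Finset.card Ψ) N.constraints i (N.childConstraints i ψ)
  rw [h1, size, ← Finset.add_sum_erase _ _ (Finset.mem_univ i), hcard]
  omega

theorem CTNode.exists_size_le [Finite V] (k B : ℕ) :
    ∃ M, ∀ N : CTNode V k, N.Early B → N.size ≤ M := by
  have hfin := Constraint.finite_time_le (V := V) B
  refine ⟨∑ _ : Fin k, hfin.toFinset.card, fun N hN => Finset.sum_le_sum fun i _ =>
    Finset.card_le_card fun ψ hψ => ?_⟩
  exact hfin.mem_toFinset.2 (hN i ψ hψ)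

/-- Decreases whenever a node is replaced with two nodes that have more constraints. -/
def weight (M : ℕ) (L : Multiset (CTNode V k)) : ℕ := (L.map fun N => 3 ^ (M - N.size)).sum

theorem weight_cons (M : ℕ) (N : CTNode V k) (L : Multiset (CTNode V k)) :
    weight M (N ::ₘ L) = 3 ^ (M - N.size) + weight M L := by
  rw [weight, Multiset.map_cons, Multiset.sum_cons]
  rfl

/-- There is no infinite run from `c`. -/
def Terminates (I : Instance V k) (P : Params V k) (c : Config V k) : Prop :=
  Acc (fun c' c => Step I P c c') c

/-- The invariants that hold in every run on an instance with solution `R`. -/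
structure Config.Valid (I : Instance V k) (P : Params V k) (R : Fin k → ℕ → V) (c : Config V k) :
    Prop where
  inv : c.Inv I P
  live : c.Live I P R

section Termination

variable {I : Instance V k} {P : Params V k} {R : Fin k → ℕ → V}

theorem Config.Valid.step (hw : 1 ≤ P.w) (hadm : P.Admissible I)
    (hdelay : ∀ N i ψ, 0 ≤ P.totalDelay N i ψ) (hR : I.IsSolution R) {c c' : Config V k}
    (hc : c.Valid I P R) (h : Step I P c c') : c'.Valid I P R :=
  ⟨hc.inv.step hw hadm hdelay h, hc.live.step (zero_le_one.trans hw) hadm hR hc.inv h⟩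

theorem terminates_returned (N : CTNode V k) : Terminates I P (.returned N) :=
  ⟨_, fun _ h => nomatch h⟩

theorem terminates_failed : Terminates I P .failed :=
  ⟨_, fun _ h => nomatch h⟩

theorem terminates_search (hw : 1 ≤ P.w) (hadm : P.Admissible I)
    (hdelay : ∀ N i ψ, 0 ≤ P.totalDelay N i ψ) (hR : I.IsSolution R)
    {L : Multiset (CTNode V k)} {N : CTNode V k} {i : Fin k} {ψ : Constraint V}
    {src : FlexSource V k} {Δ : ℝ} {S : SearchState V} {pending : List (Fin k × Constraint V)}
    (hS : Acc (fun S' S => (childQuery N i ψ Δ).Step I P S S') S)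
    (hc : (Config.search L N i ψ src Δ S pending).Valid I P R)
    (hnone : (Config.expand L N pending).Valid I P R → Terminates I P (.expand L N pending))
    (hfound : ∀ p b,
      (Config.expand (N.replan i (N.childConstraints i ψ) p b ::ₘ L) N pending).Valid I P R →
      Terminates I P (.expand (N.replan i (N.childConstraints i ψ) p b ::ₘ L) N pending)) :
    Terminates I P (.search L N i ψ src Δ S pending) := by
  induction hS with
  | intro S _ ih =>
    refine ⟨_, fun c' h => ?_⟩
    have hc' := hc.step hw hadm hdelay hR h
    cases h with
    | childStep _ _ _ _ _ _ _ S' _ h => exact ih S' h hc'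
    | childFound _ _ _ _ _ _ _ _ p b h => exact hfound p b hc'
    | childNoPath => exact hnone hc'

/-- In `hm`, `m` is the weight of LISTs when `N` was selected, and each pending child is charged the
weight it will have. A generated child moves its charge into `weight M L`; once `N` itself is
removed, the weight is below `m`. -/
theorem terminates_expand [Finite V] (hw : 1 ≤ P.w) (hadm : P.Admissible I)
    (hdelay : ∀ N i ψ, 0 ≤ P.totalDelay N i ψ) (hR : I.IsSolution R) (M m : ℕ)
    (hselect : ∀ L, weight M L < m → (Config.select L).Valid I P R → Terminates I P (.select L))
    {N : CTNode V k} (pending : List (Fin k × Constraint V)) (L : Multiset (CTNode V k))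
    (hc : (Config.expand L N pending).Valid I P R)
    (hm : weight M L + pending.length * 3 ^ (M - (N.size + 1)) < 3 ^ (M - N.size) + m) :
    Terminates I P (.expand L N pending) := by
  induction pending generalizing L with
  | nil =>
    refine ⟨_, fun c' h => ?_⟩
    have hc' := hc.step hw hadm hdelay hR h
    cases h with
    | expandDone L' =>
      rw [weight_cons] at hm
      exact hselect L' (by simp at hm; omega) hc'
  | cons a pending ih =>
    refine ⟨_, fun c' h => ?_⟩
    have hc' := hc.step hw hadm hdelay hR h
    rw [List.length_cons, add_one_mul] at hm
    cases h with
    | childStart _ _ i ψ _ src Δ h =>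
      have hE : ExpandInv I P.w L N ((i, ψ) :: pending) := hc.inv
      have hN := hE.good N hE.mem
      have hψ := hE.violates _ List.mem_cons_self
      refine terminates_search hw hadm hdelay hR
        (hc'.inv.2.2.acc (zero_le_one.trans hw) hadm (hN.childQuery_proper hψ.proper Δ)
          (hR.1 i).reachable) hc' (fun hv => ih L hv
          ((Nat.add_le_add_left (Nat.le_add_right _ _) _).trans_lt hm)) fun p b hv => ih _ hv ?_
      rw [weight_cons, hN.size_replan hψ]
      omega

theorem terminates_select [Finite V] (hw : 1 ≤ P.w) (hadm : P.Admissible I)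
    (hdelay : ∀ N i ψ, 0 ≤ P.totalDelay N i ψ) (hR : I.IsSolution R) (L : Multiset (CTNode V k))
    (hc : (Config.select L).Valid I P R) : Terminates I P (.select L) := by
  obtain ⟨M, hM⟩ := CTNode.exists_size_le (V := V) k ⌊P.w * I.soc R⌋₊
  generalize hm : weight M L = m
  induction m using Nat.strong_induction_on generalizing L with
  | _ m ih =>
    refine ⟨_, fun c' h => ?_⟩
    have hc' := hc.step hw hadm hdelay hR h
    cases h with
    | noNode => exact terminates_failed
    | solved => exact terminates_returned _
    | split _ N a b =>
      refine terminates_expand hw hadm hdelay hR M m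
        (fun L' hlt hv => ih _ hlt L' hv rfl) _ _ hc' ?_
      have hE : ExpandInv I P.w L N [a, b] := hc'.inv
      have hl : ExpandLive ⌊P.w * I.soc R⌋₊ R L N [a, b] := hc'.live
      -- A fictitious child with arbitrary path and bound 0 shows `N.size + 1 ≤ M`, so the exponent
      -- is not truncated and two children weigh less than `N`.
      have hchild := hM _ ((hl.early N hE.mem).replan (i := a.1)
        (hl.time_le a List.mem_cons_self) (N.path a.1) 0)
      rw [(hE.good N hE.mem).size_replan (hE.violates a List.mem_cons_self)] at hchild
      have hpow : 3 ^ (M - N.size) = 3 ^ (M - (N.size + 1)) * 3 := by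
        rw [← pow_succ]
        congr 1
        omega
      have hpos : 0 < 3 ^ (M - (N.size + 1)) := by positivity
      rw [hm, hpow]
      simp only [List.length_cons, List.length_nil]
      omega

theorem terminates_rootSearch (hw : 1 ≤ P.w) (hadm : P.Admissible I)
    (hdelay : ∀ N i ψ, 0 ≤ P.totalDelay N i ψ) (hR : I.IsSolution R)
    {i : Fin k} {N : CTNode V k} {S : SearchState V}
    (hS : Acc (fun S' S => (rootQuery N i).Step I P S S') S)
    (hc : (Config.rootSearch i N S).Valid I P R)
    (hnext : ∀ N', (Config.root (i + 1) N').Valid I P R → Terminates I P (.root (i + 1) N')) :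
    Terminates I P (.rootSearch i N S) := by
  induction hS with
  | intro S _ ih =>
    refine ⟨_, fun c' h => ?_⟩
    have hc' := hc.step hw hadm hdelay hR h
    cases h with
    | rootStep _ _ _ S' h => exact ih S' h hc'
    | rootFound => exact hnext _ hc'
    | rootNoPath => exact terminates_failed

theorem terminates_root [Finite V] (hw : 1 ≤ P.w) (hadm : P.Admissible I)
    (hdelay : ∀ N i ψ, 0 ≤ P.totalDelay N i ψ) (hR : I.IsSolution R) (m : ℕ) (N : CTNode V k)
    (hc : (Config.root m N).Valid I P R) : Terminates I P (.root m N) := by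
  generalize hd : k - m = d
  induction d generalizing m N with
  | zero =>
    refine ⟨_, fun c' h => ?_⟩
    have hc' := hc.step hw hadm hdelay hR h
    cases h with
    | rootNext _ i => omega
    | rootDone => exact terminates_select hw hadm hdelay hR _ hc'
  | succ d ih =>
    refine ⟨_, fun c' h => ?_⟩
    have hc' := hc.step hw hadm hdelay hR h
    cases h with
    | rootNext _ i =>
      exact terminates_rootSearch hw hadm hdelay hR
        (hc'.inv.2.acc (zero_le_one.trans hw) hadm (rootQuery_proper N i) (hR.1 i).reachable) hc'
        fun N' hv => ih _ N' hv (by omega)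
    | rootDone => exact terminates_select hw hadm hdelay hR _ hc'

end Termination

theorem complete [Finite V] {I : Instance V k} {P : Params V k} (hw : 1 ≤ P.w)
    (hadm : P.Admissible I) (hdelay : ∀ N i ψ, 0 ≤ P.totalDelay N i ψ) : Complete I P := by
  rintro ⟨R, hR⟩
  constructor
  · rintro ⟨run, h0, hrun⟩
    have hacc : Terminates I P (run 0) :=
      h0 ▸ terminates_root hw hadm hdelay hR _ _ ⟨Config.Inv.init I P, trivial⟩
    -- An infinite run never visits an accessible configuration.
    have hnot : ∀ c, Terminates I P c → ∀ n, run n ≠ c := by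
      intro c hc
      induction hc with
      | intro c _ ih =>
        rintro n rfl
        exact ih _ (hrun n) (n + 1) rfl
    exact hnot _ hacc 0 rfl
  · intro c hc hfinal
    have hinv := hc.inv hw hadm hdelay
    rcases (hc.live hw hadm hdelay hR).progress hw hdelay hinv with ⟨c', h⟩ | ⟨N, rfl⟩
    · exact absurd h (hfinal c')
    · exact ⟨N, rfl, hinv.1.isPath, hinv.2⟩

theorem boundedSuboptimal {I : Instance V k} {P : Params V k} (hw : 1 ≤ P.w)
    (hadm : P.Admissible I) (hdelay : ∀ N i ψ, 0 ≤ P.totalDelay N i ψ) :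
    BoundedSuboptimal I P := by
  intro N hN
  have hinv := hN.inv hw hadm hdelay
  have hsol : I.IsSolution N.path := ⟨hinv.1.isPath, hinv.2⟩
  -- The returned solution itself shows that the minimum is attained, so solvability need not be
  -- assumed.
  obtain ⟨R, hR, hopt⟩ : I.optCost ∈ {c | ∃ P, I.IsSolution P ∧ I.soc P = c} :=
    Nat.sInf_mem ⟨_, N.path, hsol, rfl⟩
  refine ⟨hsol, ?_⟩
  rw [← hopt]
  exact hN.live hw hadm hdelay hR

end EECBS

theorem mainTheorem2 {V : Type*} [Finite V] {k : ℕ} (I : EECBS.Instance V k)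
    (P : EECBS.Params V k) (hw : 1 ≤ P.w) (hadm : P.Admissible I)
    (hdelay : ∀ (Nhat : EECBS.CTNode V k) (i : Fin k) (ψ : EECBS.Constraint V),
      0 ≤ P.totalDelay Nhat i ψ) :
    -- EECBS with MFD is complete and bounded-suboptimal
    EECBS.Complete I P ∧ EECBS.BoundedSuboptimal I P ∧
    -- every generated CT node is locally bounded-suboptimal
    (∀ c, EECBS.Reachable I P c → ∀ N ∈ c.lists, EECBS.LocallyBounded I P.w N) ∧
    (∀ L Nhat i ψ src Δ S pending,
      EECBS.Reachable I P (.search L Nhat i ψ src Δ S pending) →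
      -- the flex never exceeds the maximum allowed flex, or it is the one of GFD
      (0 ≤ EECBS.maxFlex I P Nhat i → 0 ≤ Δ ∧ Δ ≤ EECBS.maxFlex I P Nhat i) ∧
      (EECBS.maxFlex I P Nhat i < 0 → Δ = EECBS.maxFlex I P Nhat i) ∧
      -- a child generated with the flex recomputed from `NF` is globally bounded-suboptimal
      (∀ NF p b, src = .front NF → (EECBS.childQuery Nhat i ψ Δ).Finds I P S p b →
        b = Nhat.lb i → Nhat.lb i = NF.lb i →
        EECBS.GloballyBounded I P.w L
          (Nhat.replan i (Nhat.childConstraints i ψ) p b))) := by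
  refine ⟨EECBS.complete hw hadm hdelay, EECBS.boundedSuboptimal hw hadm hdelay,
    fun c hc N hN => ?_, fun L Nhat i ψ src Δ S pending hc => ?_⟩
  · have hinv := hc.inv hw hadm hdelay
    cases c with
    | select L => exact (hinv N hN).bounded
    | expand L Nhat pending => exact (hinv.good N hN).bounded
    | search L Nhat i ψ src Δ S pending => exact (hinv.1.good N hN).bounded
    | root | rootSearch | returned | failed => exact absurd hN (Multiset.notMem_zero N)
  · obtain ⟨hE, hM, hS⟩ := hc.inv hw hadm hdelay
    refine ⟨hM.mem_Icc (zero_le_one.trans hw) (hdelay _ _ _), hM.eq_of_neg, ?_⟩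
    rintro NF p b rfl hfinds rfl hlb
    exact EECBS.globallyBounded_of_front hM (hS.result hadm
      ((hE.good Nhat hE.mem).childQuery_proper (hE.violates _ List.mem_cons_self).proper Δ)
      hfinds) hlb
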